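/- Let $G=(V,E)$ be a finite connected graph with maximum degree $\delta_{\max}$, let $m\ge 1$ be an integer and let $c:V\to\mathbb R$ satisfy $c(v)>0$ for all $v$; put $c(C)=\sum_{v\in C}c(v)$ for $C\subseteq V$. A set $C\subseteq V$ is a $(1,m)$-CDS if every node of $V\setminus C$ has at least $m$ neighbours in $C$ and the induced subgraph $G[C]$ is connected. For $C\subseteq V$ write $N_C(u)$ for the set of neighbours of $u$ in $C$, let $q_C(u)=\max\{0,m-|N_C(u)|\}$ for $u\in V\setminus C$ and $q_C(u)=0$ for $u\in C$, let $q(C)=\sum_{u\in V\setminus C}q_C(u)$, let $p(C)$ be the number of connected components of $G[C]$, and let $f=p+q$. Put $\Delta_A f(B)=f(A\cup B)-f(B)$ and $\Delta_v=\Delta_{\{v\}}$. A component neighbour of $v$ in $C$ is a component of $G[C]$ that contains $v$ or is adjacent to $v$. A star $S_u\subseteq V\setminus C$ consists of a center $u\in V\setminus C$ and feet $u_1,\dots,u_s$ ($s\ge 0$), distinct neighbours of $u$ in $V\setminus C$, enumerated so that $c(u_1)\le\dots\le c(u_s)$ (ties in any order); it is trivial if $s=0$. Let $$g_C(S_u)=-\Delta_u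 f(C)+\sum_{i=1}^s b_C^{S_u}(u_i),$$ where $b_C^{S_u}(u_i)=0$ if $q_C(u_i)>0$ and $b_C^{S_u}(u_i)=\min\{1,-\Delta_{u_i}f(C\cup\{u,u_1,\dots,u_{i-1}\})\}$ if $q_C(u_i)=0$. The cost-effectiveness of $S_u$ with respect to $C$ is $g_C(S_u)/c(S_u)$, and $S_u$ is most cost-effective if it maximizes this ratio over all stars contained in $V\setminus C$. Greedy algorithm (Algorithm 1): start with $C=\emptyset$; while some star $S\subseteq V\setminus C$ has $g_C(S)>0$, compute a star $S_u\subseteq V\setminus C$ with the star subroutine below and replace $C$ by $C\cup S_u$; output $C$. Star subroutine (Algorithm 2): for each $u\in V\setminus C$ start with $S_u=\{u\}$. If $q_C(u)=0$, go through the neighbours $v$ of $u$ that have $q_C(v)=0$ and exactly one component neighbour in $C$, this component not being a component neighbour of $u$, in an order of nondecreasing cost, and add $v$ to the current star $S_u$ as its last foot whenever $b_C^{S_u\cup\{v\}}(v)=1$ and $1/c(v)\ge g_C(S_u)/c(S_u)$. Return one of the resulting stars $S_u$, $u\in V\setminus C$, of maximum cost-effectiveness, a trivial one if possible. Theorem.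 Let $C^*$ be a $(1,m)$-CDS of $G$ of minimum cost. Algorithm 1 has an output, and every output $C$ of Algorithm 1 (however ties are broken) satisfies $$c(C)\le 2H(\delta_{\max}+m-1)\,c(C^*),\qquad H(k)=\sum_{i=1}^k\frac1i .$$ The same bound holds for every output of the variant of Algorithm 1 in which each pass of the loop adds an arbitrary most cost-effective star. -/

import Mathlib

namespace MinWCDS

variable {V : Type*} [Fintype V] [DecidableEq V]

/-- The cost `c(C) = ∑ v ∈ C, c(v)` of a node set. -/
noncomputable def cost (c : V → ℝ) (C : Finset V) : ℝ := ∑ v ∈ C, c v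

/-- `N_C(v)`: the set of neighbours of `v` in `C`. -/
def nbrsIn (G : SimpleGraph V) [DecidableRel G.Adj] (C : Finset V) (v : V) : Finset V :=
  C.filter (fun w => G.Adj v w)

/-- `C` is a `(1,m)`-CDS: every node outside `C` has at least `m` neighbours in `C`, and
`G[C]` is connected. -/
def IsCDS (G : SimpleGraph V) [DecidableRel G.Adj] (m : ℕ) (C : Finset V) : Prop :=
  (∀ v ∉ C, m ≤ (nbrsIn G C v).card) ∧ (G.induce (C : Set V)).Connected

/-- `C` is a `(1,m)`-CDS of minimum cost. -/
def IsOptimalCDS (G : SimpleGraph V) [DecidableRel G.Adj] (m : ℕ) (c : V → ℝ)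
    (C : Finset V) : Prop :=
  IsCDS G m C ∧ ∀ D : Finset V, IsCDS G m D → cost c C ≤ cost c D

/-- `q_C(v)`, equal to `max {0, m - |N_C(v)|}` for `v ∉ C` (truncated subtraction) and to `0`
for `v ∈ C`. -/
def qNode (G : SimpleGraph V) [DecidableRel G.Adj] (m : ℕ) (C : Finset V) (v : V) : ℕ :=
  if v ∈ C then 0 else m - (nbrsIn G C v).card

/-- `q(C) = ∑ v ∈ V \ C, q_C(v)`. -/
def q (G : SimpleGraph V) [DecidableRel G.Adj] (m : ℕ) (C : Finset V) : ℕ :=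
  ∑ v ∈ Cᶜ, qNode G m C v

/-- `p(C)`: the number of connected components of `G[C]`. -/
noncomputable def p (G : SimpleGraph V) (C : Finset V) : ℕ :=
  Nat.card (G.induce (C : Set V)).ConnectedComponent

/-- The potential `f(C) = p(C) + q(C)`, integer valued so that differences make sense. -/
noncomputable def f (G : SimpleGraph V) [DecidableRel G.Adj] (m : ℕ) (C : Finset V) : ℤ :=
  (p G C : ℤ) + (q G m C : ℤ)

/-- The marginal `Δ_A h(B) = h(A ∪ B) - h(B)` of a set function. -/
def marginal (h : Finset V → ℤ) (A B : Finset V) : ℤ := h (A ∪ B) - h B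

/-- The node set of the star with center `u` and list of feet `l`. -/
def starNodes (u : V) (l : List V) : Finset V := insert u l.toFinset

/-- `(u, l)` is a star contained in `V \ C`: its center is `u`, and `l` enumerates its feet,
distinct neighbours of `u`, in an order of nondecreasing cost (ties in any order).
The trivial star is the case `l = []`. -/
def IsStar (G : SimpleGraph V) (c : V → ℝ) (C : Finset V) (u : V) (l : List V) : Prop :=
  u ∉ C ∧ l.Nodup ∧ (∀ v ∈ l, G.Adj u v ∧ v ∉ C) ∧ l.Pairwise (fun v w => c v ≤ c w)

/-- The contribution `b` of a foot `v`, where `D` consists of `C`, the center and the feet that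
precede `v`: it is `0` if `q_C(v) > 0`, and `min {1, -Δ_v f(D)}` otherwise. -/
noncomputable def footGain (G : SimpleGraph V) [DecidableRel G.Adj] (m : ℕ)
    (C D : Finset V) (v : V) : ℤ :=
  if 0 < qNode G m C v then 0 else min 1 (-marginal (f G m) {v} D)

/-- The sum of the contributions of the feet in the list, taken in the order of the list. -/
noncomputable def feetGain (G : SimpleGraph V) [DecidableRel G.Adj] (m : ℕ) (C : Finset V) :
    Finset V → List V → ℤ
  | _, [] => 0
  | D, v :: l => footGain G m C D v + feetGain G m C (insert v D) l

/-- `g_C(S_u) = -Δ_u f(C) + ∑ i, b(u_i)` for the star `S_u` with center `u` and feet `l`. -/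
noncomputable def gain (G : SimpleGraph V) [DecidableRel G.Adj] (m : ℕ) (C : Finset V)
    (u : V) (l : List V) : ℤ :=
  -marginal (f G m) {u} C + feetGain G m C (insert u C) l

/-- The cost-effectiveness `g_C(S_u) / c(S_u)`. -/
noncomputable def effectiveness (G : SimpleGraph V) [DecidableRel G.Adj] (m : ℕ) (c : V → ℝ)
    (C : Finset V) (u : V) (l : List V) : ℝ :=
  (gain G m C u l : ℝ) / cost c (starNodes u l)

/-- `(u, l)` is a most cost-effective star among the stars contained in `V \ C`. -/
def IsMostCostEffective (G : SimpleGraph V) [DecidableRel G.Adj] (m : ℕ) (c : V → ℝ)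
    (C : Finset V) (u : V) (l : List V) : Prop :=
  IsStar G c C u l ∧
    ∀ w k, IsStar G c C w k → effectiveness G m c C w k ≤ effectiveness G m c C u l

/-- The component neighbours of `v` in `C`: the components of `G[C]` that contain `v` or are
adjacent to `v`. -/
def compNbrs (G : SimpleGraph V) (C : Finset V) (v : V) :
    Set (G.induce (C : Set V)).ConnectedComponent :=
  {K | ∃ x : (C : Set V),
    (G.induce (C : Set V)).connectedComponentMk x = K ∧ (v = (x : V) ∨ G.Adj v x)}

/-- `v` is a candidate foot for the center `u`: it is a neighbour of `u` with `q_C(v) = 0` that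
has exactly one component neighbour, and that component is not a component neighbour of `u`. -/
def IsCandidate (G : SimpleGraph V) [DecidableRel G.Adj] (m : ℕ) (C : Finset V) (u v : V) :
    Prop :=
  G.Adj u v ∧ qNode G m C v = 0 ∧ (compNbrs G C v).ncard = 1 ∧
    Disjoint (compNbrs G C v) (compNbrs G C u)

open Classical in
/-- One pass of the inner loop of the star subroutine: the foot `v` is appended to the feet
found so far if its contribution is `1` and `1 / c(v)` is at least the cost-effectiveness of
the current star. -/
noncomputable def tryFoot (G : SimpleGraph V) [DecidableRel G.Adj] (m : ℕ) (c : V → ℝ)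
    (C : Finset V) (u : V) (l : List V) (v : V) : List V :=
  if footGain G m C (C ∪ starNodes u l) v = 1 ∧ effectiveness G m c C u l ≤ 1 / c v then
    l ++ [v]
  else l

/-- The feet that the star subroutine finds for the center `u`, when the candidates are
processed in the order `e`. -/
noncomputable def scanFeet (G : SimpleGraph V) [DecidableRel G.Adj] (m : ℕ) (c : V → ℝ)
    (C : Finset V) (u : V) (e : List V) : List V :=
  if qNode G m C u = 0 then e.foldl (tryFoot G m c C u) [] else []

/-- `(u, l)` is a possible result of the star subroutine on input `C`: for every center
`w ∉ C` the candidates are enumerated in some order `e w` of nondecreasing cost, and among the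
stars found for the different centers one of maximum cost-effectiveness is returned, a trivial
one if there is a trivial one of maximum cost-effectiveness among them. -/
def IsSubroutineStar (G : SimpleGraph V) [DecidableRel G.Adj] (m : ℕ) (c : V → ℝ)
    (C : Finset V) (u : V) (l : List V) : Prop :=
  ∃ e : V → List V,
    (∀ w ∉ C, (e w).Nodup ∧ (∀ v, v ∈ e w ↔ IsCandidate G m C w v) ∧
      (e w).Pairwise (fun v v' => c v ≤ c v')) ∧
    u ∉ C ∧ l = scanFeet G m c C u (e u) ∧
    (∀ w ∉ C, effectiveness G m c C w (scanFeet G m c C w (e w)) ≤ effectiveness G m c C u l) ∧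
    ((∃ w ∉ C, scanFeet G m c C w (e w) = [] ∧
        effectiveness G m c C w [] = effectiveness G m c C u l) → l = [])

/-- The loop condition of the greedy algorithm: some star has a positive value of `g_C`. -/
def LoopCondition (G : SimpleGraph V) [DecidableRel G.Adj] (m : ℕ) (c : V → ℝ)
    (C : Finset V) : Prop :=
  ∃ u l, IsStar G c C u l ∧ 0 < gain G m C u l

/-- The node sets that the greedy algorithm can hold at the head of its loop, when the star
added in a pass of the loop is chosen by the (possibly nondeterministic) rule `sel`. -/
inductive Reaches (G : SimpleGraph V) [DecidableRel G.Adj] (m : ℕ) (c : V → ℝ)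
    (sel : Finset V → V → List V → Prop) : Finset V → Prop
  | start : Reaches G m c sel ∅
  | step (C : Finset V) (u : V) (l : List V) (hC : Reaches G m c sel C)
      (hloop : LoopCondition G m c C) (hsel : sel C u l) :
      Reaches G m c sel (C ∪ starNodes u l)

/-- `C` is a possible output of the greedy algorithm with selection rule `sel`. -/
def IsOutput (G : SimpleGraph V) [DecidableRel G.Adj] (m : ℕ) (c : V → ℝ)
    (sel : Finset V → V → List V → Prop) (C : Finset V) : Prop :=
  Reaches G m c sel C ∧ ¬ LoopCondition G m c C

end MinWCDS

/-!
# Greedy approximation of minimum weight `(1,m)`-connected dominating sets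

For `v ∉ C` the marginal of the potential is
`-Δ_v f(C) = q_C(v) + #{w ∉ C, w ~ v, q_C(w) > 0} + #(component neighbours of v) - 1`
(`neg_marginal_f`). The first two terms decrease in `C`, the number of component neighbours need
not; this is what the feet of a star make up for. Three facts carry the proof.

*Stars of the optimum* (`exists_star_decomposition`). In a breadth-first search tree of
`G[C*]`, each vertex together with its children is a star; a vertex lies in at most two of these
stars, so their costs `W u` add up to at most `2 c(C*)`. For every `C`, the gains of the parts
outside `C` of the stars with center outside `C` add up to at least `f(C) - 1`. To see this, every
component of `G[C]` is charged to the first vertex of `C*` that touches it. The marginal of `v ∈ C*` pays for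
all component neighbours of `v` but one. Let `u` be the parent of `v`. If `u ∈ C`, the component
of `u` is charged to an earlier vertex, and if `u ∉ C` and `q_C(v) > 0`, the deficiency of `v` is
counted in the marginals of both `u` and `v`; either makes up for the missing unit. If `u ∉ C` and
`q_C(v) = 0`, the unit is missing only when `v` touches no component charged earlier, and then the
contribution of the foot `v` to the star of `u` is `1`.

*The subroutine* (`IsSubroutineStar.isMostCostEffective`). Let no star found by the scans have a
cost-effectiveness above `R`, and take a star with the fewest feet among those whose
cost-effectiveness is above `R`. Comparing with the star without a foot `v` shows that `v`
contributes `1` and that `R c(v) < 1`; comparing with the trivial star `{v}` shows that `v` is a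
candidate with a component of its own. The scan of the same center meets the candidates in order
of cost, so it finds for each foot one that joins the same component at no greater cost, and it
reaches a cost-effectiveness above `R`.

*Amortization* (`cost_add_sum_le`). Let `D = δ_max + m - 1`. The gain of a star is at most `D`
(`gain_le_maxDegree`), and the gain of the star of `u ∈ C*` is at most `W u / θ`, where `θ` is the
price per unit of gain in the current step. Hence at least `f(C) - 1` of the numbers `W u / k`,
`1 ≤ k ≤ D`, are at least `θ` (`f_sub_one_le_card`). The potential drops by at least the gain, so
the step can be paid for with as many of these numbers as the potential drops, even if those
reserved for later steps are unavailable. The whole run therefore costs at most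
`∑ u ∈ C*, ∑ k ≤ D, W u / k ≤ 2 H(D) c(C*)`. The gains of the stars of the optimum need not be
monotone along the run, nor need the prices `θ`, and the argument uses neither.
-/

namespace MinWCDS

set_option linter.unusedSectionVars false

variable {V : Type*} [Fintype V] [DecidableEq V] {G : SimpleGraph V}

/-! ### Component neighbours -/

lemma reachable_mono {C D : Finset V} (h : C ⊆ D) {x y : V} {hx : x ∈ C} {hy : y ∈ C}
    (hr : (G.induce (C : Set V)).Reachable ⟨x, hx⟩ ⟨y, hy⟩) :
    (G.induce (D : Set V)).Reachable ⟨x, h hx⟩ ⟨y, h hy⟩ :=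
  hr.map (SimpleGraph.induceHomOfLE G (s := (C : Set V)) (s' := (D : Set V))
    (by exact_mod_cast h)).toHom

/-- Adding `v` merges the component neighbours of `v` into one component and leaves the other
components alone. -/
lemma p_insert {C : Finset V} {v : V} (hv : v ∉ C) :
    p G (insert v C) + (compNbrs G C v).ncard = p G C + 1 := by
  classical
  -- The components of `G[C ∪ {v}]` are that of `v`, sent to `none`, and the others.
  have key : p G (insert v C) = Nat.card (Option {K // K ∉ compNbrs G C v}) := by
    set C' := insert v C with hC'
    have hsub : C ⊆ C' := Finset.subset_insert _ _
    let g : ((C' : Finset V) : Set V) → Option {K // K ∉ compNbrs G C v} := fun x =>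
      if hx : (x : V) ∈ C then
        if hK : (G.induce (C : Set V)).connectedComponentMk ⟨x, hx⟩ ∈ compNbrs G C v then none
        else some ⟨_, hK⟩
      else none
    have gnone : ∀ x : ((C' : Finset V) : Set V), ∀ hx : (x : V) ∈ C, G.Adj v x → g x = none := by
      intro x hx h
      simp only [g, hx, dif_pos]
      rw [dif_pos]
      exact ⟨_, rfl, Or.inr h⟩
    have gv : ∀ x : ((C' : Finset V) : Set V), (x : V) ∉ C → (x : V) = v := by
      intro x hx
      have := x.2
      simp only [hC', Finset.coe_insert, Set.mem_insert_iff, Finset.mem_coe] at this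
      tauto
    have gnv : ∀ x : ((C' : Finset V) : Set V), (x : V) ∉ C → g x = none := by
      intro x hx
      simp only [g, hx, dif_neg, not_false_eq_true]
    have gadj : ∀ x y, (G.induce (C' : Set V)).Adj x y → g x = g y := by
      intro x y h
      have h' : G.Adj x y := h
      by_cases hx : (x : V) ∈ C <;> by_cases hy : (y : V) ∈ C
      · have : (G.induce (C : Set V)).connectedComponentMk ⟨x, hx⟩ =
            (G.induce (C : Set V)).connectedComponentMk ⟨y, hy⟩ :=
          SimpleGraph.ConnectedComponent.sound (SimpleGraph.Adj.reachable h')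
        simp only [g, hx, hy, dif_pos, this]
      · rw [gnv y hy, gnone x hx (by rw [← gv y hy]; exact h'.symm)]
      · rw [gnv x hx, gnone y hy (by rw [← gv x hx]; exact h')]
      · rw [gnv x hx, gnv y hy]
    have greach : ∀ x y, (G.induce (C' : Set V)).Reachable x y → g x = g y := by
      rintro x y ⟨w⟩
      induction w with
      | nil => rfl
      | cons h _ ih => exact (gadj _ _ h).trans ih
    have hvC' : v ∈ C' := Finset.mem_insert_self _ _
    have nonereach : ∀ x : ((C' : Finset V) : Set V), g x = none →
        (G.induce (C' : Set V)).Reachable x ⟨v, hvC'⟩ := by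
      intro x hx
      by_cases hxC : (x : V) ∈ C
      · simp only [g, hxC, dif_pos] at hx
        split_ifs at hx with hK
        obtain ⟨y, hy, hvy⟩ := hK
        have hr : (G.induce (C' : Set V)).Reachable x ⟨y, hsub y.2⟩ :=
          reachable_mono hsub (SimpleGraph.ConnectedComponent.exact hy).symm
        rcases hvy with rfl | hvy
        · exact absurd y.2 hv
        · exact hr.trans (SimpleGraph.Adj.reachable (G := G.induce (C' : Set V)) hvy.symm)
      · have : x = ⟨v, hvC'⟩ := Subtype.ext (gv x hxC)
        rw [this]
    let φ : (G.induce (C' : Set V)).ConnectedComponent → Option {K // K ∉ compNbrs G C v} :=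
      fun K => Quot.lift g greach K
    have φmk : ∀ x, φ ((G.induce (C' : Set V)).connectedComponentMk x) = g x := fun _ => rfl
    refine Nat.card_congr (Equiv.ofBijective φ ⟨?_, ?_⟩)
    · intro K L
      induction K using SimpleGraph.ConnectedComponent.ind with | _ x
      induction L using SimpleGraph.ConnectedComponent.ind with | _ y
      intro h
      rw [φmk, φmk] at h
      apply SimpleGraph.ConnectedComponent.sound
      cases hgx : g x with
      | none => exact (nonereach x hgx).trans (nonereach y (h ▸ hgx)).symm
      | some K =>
        have hgy : g y = some K := h ▸ hgx
        simp only [g] at hgx hgy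
        split_ifs at hgx with hx hKx
        split_ifs at hgy with hy hKy
        have := (Option.some.inj hgx).trans (Option.some.inj hgy).symm
        exact reachable_mono hsub
          (SimpleGraph.ConnectedComponent.exact (Subtype.ext_iff.1 this))
    · rintro (_ | ⟨K, hK⟩)
      · exact ⟨(G.induce (C' : Set V)).connectedComponentMk ⟨v, hvC'⟩, gnv _ hv⟩
      · induction K using SimpleGraph.ConnectedComponent.ind with | _ x
        refine ⟨(G.induce (C' : Set V)).connectedComponentMk ⟨x, hsub x.2⟩, ?_⟩
        rw [φmk]
        simp only [g]
        rw [dif_pos (show (x : V) ∈ C from x.2), dif_neg hK]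
  have h2 : Nat.card {K // K ∉ compNbrs G C v} + (compNbrs G C v).ncard = p G C := by
    have := Set.ncard_add_ncard_compl (compNbrs G C v)
    rw [p, ← this, add_comm]
    rfl
  rw [key, Finite.card_option]
  omega

lemma compNbrs_nonempty_of_adj {C : Finset V} {v x : V} (hx : x ∈ C) (h : G.Adj v x) :
    (compNbrs G C v).Nonempty :=
  ⟨_, ⟨x, hx⟩, rfl, Or.inr h⟩

/-- Enlarging `D` by neighbours of `u ∈ D` creates no new component neighbour of a neighbour
of `u`. -/
lemma ncard_compNbrs_antitone {D D' : Finset V} (h : D ⊆ D') {u v : V} (hu : u ∈ D)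
    (huv : G.Adj u v) (hv : v ∉ D') (hD : ∀ x ∈ D', x ∉ D → G.Adj u x) :
    (compNbrs G D' v).ncard ≤ (compNbrs G D v).ncard := by
  let φ : (G.induce (D : Set V)).ConnectedComponent → (G.induce (D' : Set V)).ConnectedComponent :=
    SimpleGraph.ConnectedComponent.map (SimpleGraph.induceHomOfLE G
      (s := (D : Set V)) (s' := (D' : Set V)) (by exact_mod_cast h)).toHom
  refine (Set.ncard_le_ncard (t := φ '' compNbrs G D v) ?_ (Set.toFinite _)).trans
    (Set.ncard_image_le (Set.toFinite _))
  rintro K ⟨x, rfl, hx | hx⟩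
  · exact absurd (hx ▸ x.2) hv
  · by_cases hxD : (x : V) ∈ D
    · exact ⟨_, ⟨⟨x, hxD⟩, rfl, Or.inr hx⟩, rfl⟩
    · refine ⟨_, ⟨⟨u, hu⟩, rfl, Or.inr huv.symm⟩, ?_⟩
      exact SimpleGraph.ConnectedComponent.sound
        (SimpleGraph.Adj.reachable (G := G.induce (D' : Set V)) (hD x x.2 hxD))

/-- If no vertex of `Z` touches a component neighbour of `v`, then `v` has a component
neighbour in `C ∪ Z` besides the one of its neighbour `u ∈ Z`. -/
lemma two_le_ncard_compNbrs {C Z : Finset V} {u v x : V} (hu : u ∈ Z) (huv : G.Adj u v)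
    (hx : x ∈ C) (hvx : G.Adj v x)
    (hdis : ∀ z ∈ Z, Disjoint (compNbrs G C v) (compNbrs G C z)) :
    2 ≤ (compNbrs G (C ∪ Z) v).ncard := by
  have hsub : C ⊆ C ∪ Z := Finset.subset_union_left
  have huD : u ∈ C ∪ Z := Finset.mem_union_right _ hu
  have hstay : ∀ a b : ((C ∪ Z : Finset V) : Set V),
      (G.induce ((C ∪ Z : Finset V) : Set V)).Reachable a b →
      (∃ h : (a : V) ∈ C, (G.induce (C : Set V)).Reachable ⟨x, hx⟩ ⟨a, h⟩) →
      (∃ h : (b : V) ∈ C, (G.induce (C : Set V)).Reachable ⟨x, hx⟩ ⟨b, h⟩) := by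
    rintro a b ⟨w⟩
    induction w with
    | nil => exact id
    | @cons a b' _ hab _ ih =>
      rintro ⟨ha, hr⟩
      have hab' : G.Adj (a : V) (b' : V) := hab
      have hKv : (G.induce (C : Set V)).connectedComponentMk ⟨a, ha⟩ ∈ compNbrs G C v :=
        ⟨⟨x, hx⟩, SimpleGraph.ConnectedComponent.sound hr, Or.inr hvx⟩
      have hbZ : (b' : V) ∉ Z := fun hb =>
        Set.disjoint_left.1 (hdis _ hb) hKv ⟨⟨a, ha⟩, rfl, Or.inr hab'.symm⟩
      have hbC : (b' : V) ∈ C := (Finset.mem_union.1 b'.2).resolve_right hbZ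
      exact ih ⟨hbC, hr.trans (SimpleGraph.Adj.reachable (G := G.induce (C : Set V)) hab')⟩
  have hne : (G.induce ((C ∪ Z : Finset V) : Set V)).connectedComponentMk ⟨x, hsub hx⟩ ≠
      (G.induce ((C ∪ Z : Finset V) : Set V)).connectedComponentMk ⟨u, huD⟩ := by
    intro h
    obtain ⟨hC, hr⟩ := hstay _ _ (SimpleGraph.ConnectedComponent.exact h)
      ⟨hx, SimpleGraph.Reachable.refl _⟩
    have hK : (G.induce (C : Set V)).connectedComponentMk ⟨u, hC⟩ ∈ compNbrs G C v :=
      ⟨⟨x, hx⟩, SimpleGraph.ConnectedComponent.sound hr, Or.inr hvx⟩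
    exact Set.disjoint_left.1 (hdis u hu) hK ⟨⟨u, hC⟩, rfl, Or.inl rfl⟩
  rw [← Set.ncard_pair hne]
  refine Set.ncard_le_ncard ?_ (Set.toFinite _)
  rintro K (rfl | rfl)
  · exact ⟨_, rfl, Or.inr hvx⟩
  · exact ⟨_, rfl, Or.inr huv.symm⟩

/-- Conversely, if a vertex `z` of a star `Z` touches the only component neighbour of `v`, then
`v` has only one component neighbour in `C ∪ Z`. -/
lemma ncard_compNbrs_le_one {C Z : Finset V} {u v z : V} (hu : u ∈ Z) (hv : v ∉ C ∪ Z)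
    (hZ : ∀ y ∈ Z, y = u ∨ G.Adj u y) (h1 : (compNbrs G C v).ncard = 1) (hz : z ∈ Z)
    (hnd : ¬ Disjoint (compNbrs G C v) (compNbrs G C z)) :
    (compNbrs G (C ∪ Z) v).ncard ≤ 1 := by
  have hsub : C ⊆ C ∪ Z := Finset.subset_union_left
  have huD : u ∈ C ∪ Z := Finset.mem_union_right _ hu
  obtain ⟨K, hK⟩ := Set.ncard_eq_one.1 h1
  have hZu : ∀ y (hy : y ∈ Z), (G.induce ((C ∪ Z : Finset V) : Set V)).Reachable
      ⟨y, Finset.mem_union_right _ hy⟩ ⟨u, huD⟩ := by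
    intro y hy
    rcases hZ y hy with rfl | h
    · exact SimpleGraph.Reachable.refl _
    · exact SimpleGraph.Adj.reachable (G := G.induce ((C ∪ Z : Finset V) : Set V)) h.symm
  obtain ⟨x, hxK, hxz⟩ : K ∈ compNbrs G C z := by
    rw [hK, Set.disjoint_singleton_left, not_not] at hnd
    exact hnd
  have hxu : (G.induce ((C ∪ Z : Finset V) : Set V)).Reachable ⟨x, hsub x.2⟩ ⟨u, huD⟩ := by
    rcases hxz with h | h
    · have := hZu z hz
      simpa only [h] using this
    · exact (SimpleGraph.Adj.reachable (G := G.induce ((C ∪ Z : Finset V) : Set V))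
        (u := ⟨x, hsub x.2⟩) (v := ⟨z, Finset.mem_union_right _ hz⟩) h.symm).trans (hZu z hz)
  have : compNbrs G (C ∪ Z) v ⊆
      {(G.induce ((C ∪ Z : Finset V) : Set V)).connectedComponentMk ⟨u, huD⟩} := by
    rintro L ⟨y, rfl, hy | hy⟩
    · exact absurd (hy ▸ y.2) hv
    · refine SimpleGraph.ConnectedComponent.sound ?_
      rcases Finset.mem_union.1 y.2 with hyC | hyZ
      · have hyK : (G.induce (C : Set V)).connectedComponentMk ⟨y, hyC⟩ ∈ compNbrs G C v :=
          ⟨_, rfl, Or.inr hy⟩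
        rw [hK, Set.mem_singleton_iff, ← hxK] at hyK
        exact (reachable_mono hsub (SimpleGraph.ConnectedComponent.exact hyK)).trans hxu
      · exact hZu y hyZ
  exact (Set.ncard_le_ncard this (Set.toFinite _)).trans (Set.ncard_singleton _).le

lemma compNbrs_eq_singleton {C : Finset V} {v : V} (hv : v ∈ C) :
    compNbrs G C v = {(G.induce (C : Set V)).connectedComponentMk ⟨v, hv⟩} := by
  ext K
  rw [Set.mem_singleton_iff]
  constructor
  · rintro ⟨x, rfl, hx | hx⟩
    · congr 1
      exact Subtype.ext hx.symm
    · exact SimpleGraph.ConnectedComponent.sound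
        (SimpleGraph.Adj.reachable (G := G.induce (C : Set V)) (v := ⟨v, hv⟩) hx.symm)
  · rintro rfl
    exact ⟨_, rfl, Or.inl rfl⟩

/-! ### Sorted enumerations and search trees -/

lemma exists_sorted_enumeration {K : Type*} [LinearOrder K] (key : V → K) (s : Finset V) :
    ∃ l : List V, l.Nodup ∧ (∀ v, v ∈ l ↔ v ∈ s) ∧ l.Pairwise (fun v w => key v ≤ key w) := by
  classical
  let r : V → V → Prop := fun v w => key v ≤ key w
  have : Std.Total r := ⟨fun a b => le_total (key a) (key b)⟩
  have : IsTrans V r := ⟨fun a b c => le_trans⟩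
  refine ⟨s.toList.insertionSort r, ?_, ?_, ?_⟩
  · exact (List.perm_insertionSort r _).nodup_iff.2 s.nodup_toList
  · intro v
    rw [List.mem_insertionSort, Finset.mem_toList]
  · exact List.pairwise_insertionSort r _

/-- A breadth-first search tree of `G[Cs]`, given by its root, the parents and the depths. -/
lemma exists_search_tree {Cs : Finset V} (h : (G.induce (Cs : Set V)).Connected) :
    ∃ r ∈ Cs, ∃ (par : V → V) (d : V → ℕ), ∀ v ∈ Cs, v ≠ r →
      par v ∈ Cs ∧ G.Adj (par v) v ∧ d v = d (par v) + 1 := by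
  classical
  obtain ⟨r⟩ := h.nonempty
  let d : V → ℕ := fun v => if hv : v ∈ Cs then (G.induce (Cs : Set V)).dist r ⟨v, hv⟩ else 0
  have key : ∀ v ∈ Cs, v ≠ r → ∃ w, w ∈ Cs ∧ G.Adj w v ∧ d v = d w + 1 := by
    intro v hv hvr
    obtain ⟨w, hw⟩ := h.exists_walk_length_eq_dist ⟨v, hv⟩ r
    cases w with
    | nil => exact absurd rfl hvr
    | @cons _ x _ hadj w =>
      refine ⟨x, x.2, (show G.Adj v x from hadj).symm, ?_⟩
      have hxs : (x : V) ∈ Cs := x.2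
      simp only [d, hv, hxs, dif_pos]
      rw [SimpleGraph.Walk.length_cons, SimpleGraph.dist_comm] at hw
      have h1 := SimpleGraph.dist_le w
      rw [SimpleGraph.dist_comm] at h1
      have h2 := h.dist_triangle (u := r) (v := x) (w := ⟨v, hv⟩)
      have h3 : (G.induce (Cs : Set V)).dist x ⟨v, hv⟩ ≤ 1 := by
        simpa using SimpleGraph.dist_le (SimpleGraph.Walk.cons hadj.symm SimpleGraph.Walk.nil)
      change (G.induce (Cs : Set V)).dist r ⟨v, hv⟩ = (G.induce (Cs : Set V)).dist r x + 1
      omega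
  choose! par hpar using key
  exact ⟨r, r.2, par, d, hpar⟩

/-! ### Marginals of the potential -/

variable [DecidableRel G.Adj] {m : ℕ}

lemma qNode_antitone {C D : Finset V} (h : C ⊆ D) (v : V) : qNode G m D v ≤ qNode G m C v := by
  unfold qNode
  have : (nbrsIn G C v).card ≤ (nbrsIn G D v).card :=
    Finset.card_le_card (Finset.filter_subset_filter _ h)
  split_ifs with h1 h2
  · exact le_rfl
  · exact Nat.zero_le _
  · exact absurd (h (by assumption)) h1
  · omega

/-- The neighbours `w ∉ C` of `v` that still lack neighbours in `C`. -/
def needyNbrs (G : SimpleGraph V) [DecidableRel G.Adj] (m : ℕ) (C : Finset V) (v : V) :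
    Finset V :=
  Cᶜ.filter (fun w => G.Adj v w ∧ 0 < qNode G m C w)

lemma needyNbrs_antitone {C D : Finset V} (h : C ⊆ D) (v : V) :
    needyNbrs G m D v ⊆ needyNbrs G m C v := by
  intro w
  simp only [needyNbrs, Finset.mem_filter, Finset.mem_compl]
  rintro ⟨h1, h2, h3⟩
  exact ⟨fun h4 => h1 (h h4), h2, h3.trans_le (qNode_antitone h w)⟩

lemma q_insert {C : Finset V} {v : V} (hv : v ∉ C) :
    q G m (insert v C) + qNode G m C v + (needyNbrs G m C v).card = q G m C := by
  have e1 : Cᶜ = insert v (insert v C)ᶜ := by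
    ext x; simp only [Finset.mem_compl, Finset.mem_insert]; by_cases x = v <;> simp_all
  have e2 : (needyNbrs G m C v) =
      (insert v C)ᶜ.filter (fun w => G.Adj v w ∧ 0 < qNode G m C w) := by
    ext x
    simp only [needyNbrs, Finset.mem_filter, Finset.mem_compl, Finset.mem_insert]
    constructor
    · rintro ⟨a, b, c⟩
      exact ⟨by rintro (rfl | h); exacts [G.loopless.irrefl _ b, a h], b, c⟩
    · rintro ⟨a, b, c⟩
      exact ⟨fun h => a (Or.inr h), b, c⟩
  have e3 : q G m C = qNode G m C v + ∑ w ∈ (insert v C)ᶜ, qNode G m C w := by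
    unfold q
    rw [e1, Finset.sum_insert (by simp)]
  rw [e3, e2, Finset.card_filter, q, add_right_comm, ← Finset.sum_add_distrib, add_comm]
  congr 1
  apply Finset.sum_congr rfl
  intro w hw
  simp only [Finset.mem_compl, Finset.mem_insert, not_or] at hw
  have hw2 : w ∉ insert v C := by simp [hw]
  unfold qNode
  rw [if_neg hw2, if_neg hw.2]
  have hn : nbrsIn G (insert v C) w =
      if G.Adj v w then insert v (nbrsIn G C w) else nbrsIn G C w := by
    unfold nbrsIn
    rw [Finset.filter_insert]
    simp only [G.adj_comm w v]
  have hvn : v ∉ nbrsIn G C w := fun h => hv (Finset.mem_filter.1 h).1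
  rw [hn]
  by_cases ha : G.Adj v w
  · rw [if_pos ha, Finset.card_insert_of_notMem hvn]
    simp only [ha, true_and]
    split_ifs <;> omega
  · simp [ha]

lemma neg_marginal_f {C : Finset V} {v : V} (hv : v ∉ C) :
    -marginal (f G m) {v} C =
      qNode G m C v + (needyNbrs G m C v).card + (compNbrs G C v).ncard - 1 := by
  have h1 := p_insert (G := G) hv
  have h2 := q_insert (G := G) (m := m) hv
  have e : {v} ∪ C = insert v C := rfl
  unfold marginal f
  rw [e]
  omega

lemma exists_adj_of_qNode_eq_zero (hm : 1 ≤ m) {C : Finset V} {v : V} (hv : v ∉ C)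
    (h : qNode G m C v = 0) : ∃ x ∈ C, G.Adj v x := by
  unfold qNode at h
  rw [if_neg hv] at h
  have : 0 < (nbrsIn G C v).card := by omega
  obtain ⟨x, hx⟩ := Finset.card_pos.1 this
  exact ⟨x, (Finset.mem_filter.1 hx).1, (Finset.mem_filter.1 hx).2⟩

lemma ncard_compNbrs_le {C : Finset V} {v : V} (hv : v ∉ C) :
    (compNbrs G C v).ncard ≤ (nbrsIn G C v).card := by
  classical
  rw [← Set.ncard_coe_finset, ← Nat.card_coe_set_eq, ← Nat.card_coe_set_eq]
  apply Nat.card_le_card_of_surjective (fun x : (nbrsIn G C v : Set V) =>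
    (⟨(G.induce (C : Set V)).connectedComponentMk ⟨x, (Finset.mem_filter.1 x.2).1⟩,
      _, rfl, Or.inr (Finset.mem_filter.1 x.2).2⟩ : compNbrs G C v))
  rintro ⟨K, x, rfl, hx | hx⟩
  · exact absurd (hx ▸ x.2) hv
  · exact ⟨⟨x, Finset.mem_filter.2 ⟨x.2, hx⟩⟩, rfl⟩

/-! ### The gain of a star -/

lemma footGain_le_one (C D : Finset V) (v : V) : footGain G m C D v ≤ 1 := by
  unfold footGain
  split_ifs
  · exact zero_le_one
  · exact min_le_left _ _

lemma one_le_ncard_compNbrs {D : Finset V} {u v : V} (hu : u ∈ D) (huv : G.Adj u v) :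
    1 ≤ (compNbrs G D v).ncard :=
  (Set.ncard_pos (Set.toFinite _)).2 (compNbrs_nonempty_of_adj hu huv.symm)

/-- A foot is adjacent to the center, hence adding it does not create a component. -/
lemma neg_marginal_foot_nonneg {D : Finset V} {u v : V} (hu : u ∈ D) (huv : G.Adj u v)
    (hv : v ∉ D) : 0 ≤ -marginal (f G m) {v} D := by
  rw [neg_marginal_f hv]
  have := one_le_ncard_compNbrs hu huv
  omega

lemma footGain_nonneg (C : Finset V) {D : Finset V} {u v : V} (hu : u ∈ D) (huv : G.Adj u v)
    (hv : v ∉ D) : 0 ≤ footGain G m C D v := by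
  unfold footGain
  split_ifs
  · exact le_rfl
  · exact le_min zero_le_one (neg_marginal_foot_nonneg hu huv hv)

lemma footGain_le_neg_marginal (C : Finset V) {D : Finset V} {u v : V} (hu : u ∈ D)
    (huv : G.Adj u v) (hv : v ∉ D) : footGain G m C D v ≤ -marginal (f G m) {v} D := by
  unfold footGain
  split_ifs
  · exact neg_marginal_foot_nonneg hu huv hv
  · exact min_le_right _ _

lemma footGain_antitone (C : Finset V) {D D' : Finset V} (h : D ⊆ D') {u v : V} (hu : u ∈ D)
    (huv : G.Adj u v) (hv : v ∉ D') (hD : ∀ x ∈ D', x ∉ D → G.Adj u x) :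
    footGain G m C D' v ≤ footGain G m C D v := by
  unfold footGain
  split_ifs
  · exact le_rfl
  · refine min_le_min_left _ ?_
    rw [neg_marginal_f hv, neg_marginal_f (fun h' => hv (h h'))]
    have h1 := qNode_antitone (G := G) (m := m) h v
    have h2 := Finset.card_le_card (needyNbrs_antitone (G := G) (m := m) h v)
    have h3 := ncard_compNbrs_antitone h hu huv hv hD
    omega

/-- A foot that joins a component untouched by the center and the earlier feet contributes
`1`. -/
lemma footGain_eq_one (hm : 1 ≤ m) {C Z : Finset V} {u v : V} (hu : u ∈ Z) (huv : G.Adj u v)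
    (hvC : v ∉ C) (hvZ : v ∉ Z) (hq : qNode G m C v = 0)
    (hdis : ∀ z ∈ Z, Disjoint (compNbrs G C v) (compNbrs G C z)) :
    footGain G m C (C ∪ Z) v = 1 := by
  obtain ⟨x, hx, hvx⟩ := exists_adj_of_qNode_eq_zero hm hvC hq
  have h2 := two_le_ncard_compNbrs hu huv hx hvx hdis
  unfold footGain
  rw [if_neg (by omega), neg_marginal_f (by simp [hvC, hvZ])]
  omega

lemma feetGain_append (C : Finset V) (l₁ l₂ : List V) (D : Finset V) :
    feetGain G m C D (l₁ ++ l₂) =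
      feetGain G m C D l₁ + feetGain G m C (D ∪ l₁.toFinset) l₂ := by
  induction l₁ generalizing D with
  | nil => simp [feetGain]
  | cons v l ih =>
    have : insert v D ∪ l.toFinset = D ∪ (v :: l).toFinset := by
      ext; simp
    rw [List.cons_append, feetGain, feetGain, ih, this, add_assoc]

lemma feetGain_le_length (C : Finset V) (l : List V) (D : Finset V) :
    feetGain G m C D l ≤ l.length := by
  induction l generalizing D with
  | nil => simp [feetGain]
  | cons v l ih =>
    have h1 := footGain_le_one (G := G) (m := m) C D v
    have h2 := ih (insert v D)
    simp only [feetGain, List.length_cons]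
    push_cast
    omega

lemma feetGain_antitone (C : Finset V) {u : V} (l : List V) {D D' : Finset V} (h : D ⊆ D')
    (hu : u ∈ D) (hl : l.Nodup) (hadj : ∀ v ∈ l, G.Adj u v ∧ v ∉ D')
    (hD : ∀ x ∈ D', x ∉ D → G.Adj u x) :
    feetGain G m C D' l ≤ feetGain G m C D l := by
  induction l generalizing D D' with
  | nil => simp [feetGain]
  | cons v l ih =>
    rw [List.nodup_cons] at hl
    have hv := hadj v List.mem_cons_self
    simp only [feetGain]
    refine add_le_add (footGain_antitone C h hu hv.1 hv.2 hD)
      (ih (Finset.insert_subset_insert _ h) (Finset.mem_insert_of_mem hu) hl.2 ?_ ?_)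
    · intro w hw
      refine ⟨(hadj w (List.mem_cons_of_mem _ hw)).1, ?_⟩
      rw [Finset.mem_insert, not_or]
      exact ⟨fun e => hl.1 (e ▸ hw), (hadj w (List.mem_cons_of_mem _ hw)).2⟩
    · intro x hx hx'
      simp only [Finset.mem_insert, not_or] at hx hx'
      exact hD x (hx.resolve_left hx'.1) hx'.2

lemma feetGain_le_sub (C : Finset V) {u : V} (l : List V) {D : Finset V}
    (hu : u ∈ D) (hl : l.Nodup) (hadj : ∀ v ∈ l, G.Adj u v ∧ v ∉ D) :
    feetGain G m C D l ≤ f G m D - f G m (D ∪ l.toFinset) := by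
  induction l generalizing D with
  | nil => simp [feetGain]
  | cons v l ih =>
    rw [List.nodup_cons] at hl
    have hv := hadj v List.mem_cons_self
    have h1 := footGain_le_neg_marginal (m := m) C hu hv.1 hv.2
    have h2 := ih (D := insert v D) (Finset.mem_insert_of_mem hu) hl.2 (fun w hw => by
      refine ⟨(hadj w (List.mem_cons_of_mem _ hw)).1, ?_⟩
      rw [Finset.mem_insert, not_or]
      exact ⟨fun e => hl.1 (e ▸ hw), (hadj w (List.mem_cons_of_mem _ hw)).2⟩)
    have e1 : insert v D ∪ l.toFinset = D ∪ (v :: l).toFinset := by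
      ext; simp
    have e2 : ({v} : Finset V) ∪ D = insert v D := rfl
    rw [e1] at h2
    unfold marginal at h1
    rw [e2] at h1
    simp only [feetGain]
    omega

lemma IsStar.feet {c : V → ℝ} {C : Finset V} {u : V} {l : List V} (h : IsStar G c C u l) :
    ∀ v ∈ l, G.Adj u v ∧ v ∉ insert u C := by
  intro v hv
  obtain ⟨h1, h2⟩ := h.2.2.1 v hv
  refine ⟨h1, ?_⟩
  rw [Finset.mem_insert, not_or]
  exact ⟨h1.ne', h2⟩

/-- The potential drops by at least the gain when a star is added. -/
lemma gain_le_sub {c : V → ℝ} {C : Finset V} {u : V} {l : List V} (h : IsStar G c C u l) :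
    gain G m C u l ≤ f G m C - f G m (C ∪ starNodes u l) := by
  have h1 := feetGain_le_sub (m := m) C l (Finset.mem_insert_self u C) h.2.1 h.feet
  have e1 : insert u C ∪ l.toFinset = C ∪ starNodes u l := by
    ext; simp [starNodes]
  have e2 : ({u} : Finset V) ∪ C = insert u C := rfl
  rw [e1] at h1
  unfold gain marginal
  rw [e2]
  omega

lemma feetGain_le_card_filter (C : Finset V) (l : List V) (D : Finset V) (hl : l.Nodup) :
    feetGain G m C D l ≤ (l.toFinset.filter (fun v => qNode G m C v = 0)).card := by
  induction l generalizing D with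
  | nil => simp [feetGain]
  | cons v l ih =>
    rw [List.nodup_cons] at hl
    have h2 := ih (insert v D) hl.2
    simp only [feetGain, List.toFinset_cons, Finset.filter_insert]
    by_cases hq : qNode G m C v = 0
    · rw [if_pos hq, Finset.card_insert_of_notMem (by simp [hl.1])]
      have h1 := footGain_le_one (G := G) (m := m) C D v
      push_cast
      omega
    · rw [if_neg hq, footGain, if_pos (by omega)]
      omega

/-- Each neighbour of the center contributes at most `1` to the gain: it lies in a component
neighbour, or lacks neighbours in `C`, or is a foot. The center itself contributes at most
`m - 1`. -/
lemma gain_le_maxDegree (hm : 1 ≤ m) {c : V → ℝ} {C : Finset V} {u : V} {l : List V}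
    (h : IsStar G c C u l) : gain G m C u l ≤ ((G.maxDegree + m - 1 : ℕ) : ℤ) := by
  have h1 := feetGain_le_card_filter (G := G) (m := m) C l (insert u C) h.2.1
  have h2 := ncard_compNbrs_le (G := G) h.1
  have h3 : qNode G m C u ≤ m := by
    unfold qNode
    split_ifs <;> omega
  have h4 : (nbrsIn G C u).card + (needyNbrs G m C u).card +
      (l.toFinset.filter (fun v => qNode G m C v = 0)).card ≤ G.degree u := by
    rw [← G.card_neighborFinset_eq_degree, ← Finset.card_union_of_disjoint,
      ← Finset.card_union_of_disjoint]
    · apply Finset.card_le_card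
      intro x hx
      simp only [nbrsIn, needyNbrs, Finset.mem_union, Finset.mem_filter, List.mem_toFinset] at hx
      rw [SimpleGraph.mem_neighborFinset]
      rcases hx with (hx | hx) | hx
      · exact hx.2
      · exact hx.2.1
      · exact (h.2.2.1 x hx.1).1
    · rw [Finset.disjoint_left]
      intro x hx hx'
      simp only [nbrsIn, needyNbrs, Finset.mem_union, Finset.mem_filter, List.mem_toFinset]
        at hx hx'
      rcases hx with hx | hx
      · exact (h.2.2.1 x hx'.1).2 hx.1
      · omega
    · rw [Finset.disjoint_left]
      intro x hx hx'
      simp only [nbrsIn, needyNbrs, Finset.mem_filter, Finset.mem_compl] at hx hx'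
      exact hx'.1 hx.1
  have h5 := G.degree_le_maxDegree u
  unfold gain
  rw [neg_marginal_f h.1]
  omega

lemma gain_le_add_length (C : Finset V) (u : V) (l : List V) :
    gain G m C u l ≤ -marginal (f G m) {u} C + l.length := by
  unfold gain
  have := feetGain_le_length (G := G) (m := m) C l (insert u C)
  omega

lemma gain_nil (C : Finset V) (u : V) : gain G m C u [] = -marginal (f G m) {u} C := by
  simp [gain, feetGain]

lemma gain_append_singleton (C : Finset V) (u v : V) (l : List V) :
    gain G m C u (l ++ [v]) = gain G m C u l + footGain G m C (C ∪ starNodes u l) v := by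
  have e1 : insert u C ∪ l.toFinset = C ∪ starNodes u l := by
    ext; simp [starNodes]
  rw [gain, feetGain_append, e1, gain, feetGain, feetGain]
  ring

/-- Omitting a foot costs the star no more than the contribution of that foot. -/
lemma gain_append_cons_le {c : V → ℝ} {C : Finset V} {u v : V} {l₁ l₂ : List V}
    (h : IsStar G c C u (l₁ ++ v :: l₂)) :
    gain G m C u (l₁ ++ v :: l₂) ≤
      gain G m C u (l₁ ++ l₂) + footGain G m C (C ∪ starNodes u l₁) v := by
  have e1 : insert u C ∪ l₁.toFinset = C ∪ starNodes u l₁ := by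
    ext; simp [starNodes]
  have hnd := h.2.1
  rw [List.nodup_append, List.nodup_cons] at hnd
  have := feetGain_antitone (m := m) C (u := u) l₂ (D := C ∪ starNodes u l₁)
    (D' := insert v (C ∪ starNodes u l₁)) (Finset.subset_insert _ _)
    (by simp [starNodes]) hnd.2.1.2 (fun w hw => by
      have hw' := h.feet w (by simp [hw])
      refine ⟨hw'.1, ?_⟩
      simp only [Finset.mem_insert, not_or] at hw'
      simp only [starNodes, Finset.mem_insert, Finset.mem_union, List.mem_toFinset, not_or]
      exact ⟨fun e => hnd.2.1.1 (e ▸ hw), hw'.2.2, hw'.2.1,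
        fun hw1 => hnd.2.2 w hw1 w (List.mem_cons_of_mem _ hw) rfl⟩)
    (fun x hx hx' => by
      rw [Finset.mem_insert] at hx
      have : x = v := hx.resolve_right hx'
      rw [this]
      exact (h.feet v (by simp)).1)
  rw [gain, gain, feetGain_append, feetGain_append, e1, feetGain]
  omega

lemma cost_starNodes (c : V → ℝ) {u : V} {l : List V} (hu : u ∉ l) (hl : l.Nodup) :
    cost c (starNodes u l) = c u + (l.map c).sum := by
  rw [cost, starNodes, Finset.sum_insert (by simpa using hu), List.sum_toFinset _ hl]

lemma IsStar.center_notMem {c : V → ℝ} {C : Finset V} {u : V} {l : List V}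
    (h : IsStar G c C u l) : u ∉ l := fun hu => G.loopless.irrefl u (h.2.2.1 u hu).1

lemma cost_starNodes_pos {c : V → ℝ} (hc : ∀ v, 0 < c v) (u : V) (l : List V) :
    0 < cost c (starNodes u l) :=
  Finset.sum_pos (fun v _ => hc v) ⟨u, Finset.mem_insert_self _ _⟩

/-! ### Decomposing a connected dominating set into stars -/

/-- Charge every component of `G[C]` to the first vertex of `Cs`, in the order of `key`, that
touches it. A vertex `v` whose parent touches one of the component neighbours of `v` is charged
with all but one of them at most. -/
lemma p_le {K : Type*} [LinearOrder K] {C Cs : Finset V}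
    (hdom : ∀ x ∉ Cs, ∃ y ∈ Cs, G.Adj x y) (key : V → K) {r : V} {par : V → V}
    (hpar : ∀ v ∈ Cs, v ≠ r → par v ∈ Cs ∧ G.Adj (par v) v ∧ key (par v) < key v)
    (t : V → ℤ) (ht0 : ∀ v, 0 ≤ t v)
    (ht : ∀ v ∈ Cs, v ∉ C → v ≠ r → par v ∉ C →
      (∀ w ∈ Cs, key w < key v → Disjoint (compNbrs G C v) (compNbrs G C w)) → 1 ≤ t v) :
    (p G C : ℤ) ≤ 1 + ∑ v ∈ Cs \ C, (((compNbrs G C v).ncard : ℤ) - 1 + t v) := by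
  classical
  have := Fintype.ofFinite (G.induce (C : Set V)).ConnectedComponent
  let new : V → Finset (G.induce (C : Set V)).ConnectedComponent := fun v =>
    Finset.univ.filter (fun L => L ∈ compNbrs G C v ∧
      ∀ w ∈ Cs, key w < key v → L ∉ compNbrs G C w)
  have hcover : (Finset.univ : Finset (G.induce (C : Set V)).ConnectedComponent) ⊆
      Cs.biUnion new := by
    intro L _
    have hne : (Cs.filter (fun v => L ∈ compNbrs G C v)).Nonempty := by
      induction L using SimpleGraph.ConnectedComponent.ind with | _ x
      by_cases hx : (x : V) ∈ Cs
      · exact ⟨x, Finset.mem_filter.2 ⟨hx, x, rfl, Or.inl rfl⟩⟩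
      · obtain ⟨y, hy, hxy⟩ := hdom x hx
        exact ⟨y, Finset.mem_filter.2 ⟨hy, x, rfl, Or.inr hxy.symm⟩⟩
    obtain ⟨v, hv, hmin⟩ := Finset.exists_min_image _ key hne
    rw [Finset.mem_filter] at hv
    rw [Finset.mem_biUnion]
    refine ⟨v, hv.1, Finset.mem_filter.2 ⟨Finset.mem_univ _, hv.2, ?_⟩⟩
    intro w hw hlt hLw
    exact absurd (hmin w (Finset.mem_filter.2 ⟨hw, hLw⟩)) (not_le.2 hlt)
  have hnew_sub : ∀ v, (new v : Set (G.induce (C : Set V)).ConnectedComponent) ⊆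
      compNbrs G C v := fun v L hL => (Finset.mem_filter.1 (Finset.mem_coe.1 hL)).2.1
  have hnew_le : ∀ v, ((new v).card : ℤ) ≤ (compNbrs G C v).ncard := by
    intro v
    rw [← Set.ncard_coe_finset]
    exact_mod_cast Set.ncard_le_ncard (hnew_sub v) (Set.toFinite _)
  have hnew_lt : ∀ v, ∀ w ∈ Cs, key w < key v →
      ¬ Disjoint (compNbrs G C v) (compNbrs G C w) →
      ((new v).card : ℤ) + 1 ≤ (compNbrs G C v).ncard := by
    intro v w hw hlt hnd
    obtain ⟨L, hLv, hLw⟩ := Set.not_disjoint_iff.1 hnd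
    rw [← Set.ncard_coe_finset]
    have : (new v : Set (G.induce (C : Set V)).ConnectedComponent).ncard <
        (compNbrs G C v).ncard := by
      refine Set.ncard_lt_ncard ⟨hnew_sub v, fun hsub => ?_⟩
        (Set.toFinite _)
      exact (Finset.mem_filter.1 (hsub hLv)).2.2 w hw hlt hLw
    exact_mod_cast this
  have hpt : ∀ v ∈ Cs, ((new v).card : ℤ) ≤ (if v = r then 1 else 0) +
      (if v ∉ C then ((compNbrs G C v).ncard : ℤ) - 1 + t v else 0) := by
    intro v hv
    by_cases hvC : v ∈ C
    · have h1 : (compNbrs G C v).ncard = 1 := by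
        rw [compNbrs_eq_singleton hvC, Set.ncard_singleton]
      rw [if_neg (not_not.2 hvC)]
      by_cases hvr : v = r
      · have := hnew_le v
        rw [if_pos hvr]
        omega
      · obtain ⟨h2, h3, h4⟩ := hpar v hv hvr
        have := hnew_lt v (par v) h2 h4 (by
          rw [compNbrs_eq_singleton hvC, Set.disjoint_singleton_left, not_not]
          exact ⟨_, rfl, Or.inr h3⟩)
        rw [if_neg hvr]
        omega
    · rw [if_pos hvC]
      have h0 := ht0 v
      by_cases hvr : v = r
      · have := hnew_le v
        rw [if_pos hvr]
        omega
      · obtain ⟨h2, h3, h4⟩ := hpar v hv hvr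
        rw [if_neg hvr]
        by_cases hd : ∀ w ∈ Cs, key w < key v → Disjoint (compNbrs G C v) (compNbrs G C w)
        · by_cases hpC : par v ∈ C
          · exfalso
            have := hd _ h2 h4
            rw [compNbrs_eq_singleton hpC, Set.disjoint_singleton_right] at this
            exact this ⟨_, rfl, Or.inr h3.symm⟩
          · have h5 := ht v hv hvC hvr hpC hd
            have := hnew_le v
            omega
        · push Not at hd
          obtain ⟨w, hw, hlt, hnd⟩ := hd
          have := hnew_lt v w hw hlt hnd
          omega
  have hcard : (p G C : ℤ) ≤ ∑ v ∈ Cs, ((new v).card : ℤ) := by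
    have := (Finset.card_le_card hcover).trans Finset.card_biUnion_le
    rw [p, Nat.card_eq_fintype_card]
    exact_mod_cast this
  refine hcard.trans ((Finset.sum_le_sum hpt).trans ?_)
  rw [Finset.sum_add_distrib, Finset.sdiff_eq_filter, Finset.sum_filter]
  refine add_le_add ?_ le_rfl
  rw [Finset.sum_ite_eq']
  split_ifs <;> simp

/-- The deficiencies of the vertices outside `Cs` are covered by their neighbours in `Cs \ C`;
a deficient vertex of `Cs \ C` is counted once more by its parent. -/
lemma q_le {C Cs : Finset V} (hdom : ∀ v ∉ Cs, m ≤ (nbrsIn G Cs v).card) {r : V} {par : V → V}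
    (hpar : ∀ v ∈ Cs, v ≠ r → par v ∈ Cs ∧ G.Adj (par v) v) :
    q G m C + ((Cs \ C).filter
        (fun v => v ≠ r ∧ par v ∉ C ∧ 0 < qNode G m C v)).card ≤
      ∑ u ∈ Cs \ C, (qNode G m C u + (needyNbrs G m C u).card) := by
  have e1 : ∑ u ∈ Cs \ C, (needyNbrs G m C u).card =
      ∑ w ∈ Cᶜ, ((Cs \ C).filter (fun u => G.Adj u w ∧ 0 < qNode G m C w)).card := by
    simp only [needyNbrs, Finset.card_filter]
    exact Finset.sum_comm
  have e2 : ∑ u ∈ Cs \ C, qNode G m C u = ∑ w ∈ Cᶜ, if w ∈ Cs then qNode G m C w else 0 := by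
    rw [← Finset.sum_filter]
    congr 1
    ext x; simp [and_comm]
  have e3 : ((Cs \ C).filter (fun v => v ≠ r ∧ par v ∉ C ∧ 0 < qNode G m C v)).card =
      ∑ w ∈ Cᶜ, if w ∈ Cs ∧ w ≠ r ∧ par w ∉ C ∧ 0 < qNode G m C w then 1 else 0 := by
    rw [← Finset.card_filter]
    congr 1
    ext x; simp; tauto
  rw [Finset.sum_add_distrib, e1, e2, e3, q, ← Finset.sum_add_distrib,
    ← Finset.sum_add_distrib]
  refine Finset.sum_le_sum fun w hw => ?_
  rw [Finset.mem_compl] at hw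
  by_cases hwCs : w ∈ Cs
  · rw [if_pos hwCs]
    refine Nat.add_le_add_left ?_ _
    split_ifs with h
    · obtain ⟨h1, h2⟩ := hpar w hwCs h.2.1
      exact Finset.card_pos.2 ⟨par w, Finset.mem_filter.2
        ⟨Finset.mem_sdiff.2 ⟨h1, h.2.2.1⟩, h2, h.2.2.2⟩⟩
    · exact Nat.zero_le _
  · rw [if_neg hwCs, if_neg (fun h => hwCs h.1), zero_add, add_zero]
    by_cases hq : 0 < qNode G m C w
    · have h1 := hdom w hwCs
      have h2 : (nbrsIn G Cs w).card ≤ (nbrsIn G C w).card +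
          ((Cs \ C).filter (fun u => G.Adj u w ∧ 0 < qNode G m C w)).card := by
        refine (Finset.card_le_card ?_).trans (Finset.card_union_le _ _)
        intro x hx
        simp only [nbrsIn, Finset.mem_filter, Finset.mem_union, Finset.mem_sdiff] at hx ⊢
        by_cases hxC : x ∈ C
        · exact Or.inl ⟨hxC, hx.2⟩
        · exact Or.inr ⟨⟨hx.1, hxC⟩, hx.2.symm, hq⟩
      unfold qNode at h2 ⊢
      rw [if_neg hw] at h2 ⊢
      omega
    · omega

lemma card_filter_le_feetGain (hm : 1 ≤ m) {C : Finset V} {u : V} (P : V → Prop)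
    [DecidablePred P] (l : List V) {Z : Finset V} (hu : u ∈ Z) (hl : l.Nodup)
    (hadj : ∀ v ∈ l, G.Adj u v ∧ v ∉ C ∧ v ∉ Z)
    (hP : ∀ v ∈ l, P v → qNode G m C v = 0 ∧
      ∀ z ∈ Z, Disjoint (compNbrs G C v) (compNbrs G C z))
    (hpw : l.Pairwise (fun a b => P b → Disjoint (compNbrs G C b) (compNbrs G C a))) :
    ((l.toFinset.filter P).card : ℤ) ≤ feetGain G m C (C ∪ Z) l := by
  induction l generalizing Z with
  | nil => simp [feetGain]
  | cons v l ih =>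
    rw [List.nodup_cons] at hl
    rw [List.pairwise_cons] at hpw
    have hv := hadj v List.mem_cons_self
    have h2 := ih (Z := insert v Z) (Finset.mem_insert_of_mem hu) hl.2
      (fun w hw => by
        have := hadj w (List.mem_cons_of_mem _ hw)
        refine ⟨this.1, this.2.1, ?_⟩
        rw [Finset.mem_insert, not_or]
        exact ⟨fun e => hl.1 (e ▸ hw), this.2.2⟩)
      (fun w hw hPw => by
        have := hP w (List.mem_cons_of_mem _ hw) hPw
        refine ⟨this.1, fun z hz => ?_⟩
        rcases Finset.mem_insert.1 hz with rfl | hz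
        · exact hpw.1 w hw hPw
        · exact this.2 z hz)
      hpw.2
    have e1 : C ∪ insert v Z = insert v (C ∪ Z) := Finset.union_insert _ _ _
    rw [e1] at h2
    simp only [feetGain, List.toFinset_cons, Finset.filter_insert]
    by_cases hPv : P v
    · rw [if_pos hPv, Finset.card_insert_of_notMem (by simp [hl.1])]
      have h3 := hP v List.mem_cons_self hPv
      rw [footGain_eq_one hm hu hv.1 hv.2.1 hv.2.2 h3.1 h3.2]
      push_cast
      omega
    · rw [if_neg hPv]
      have := footGain_nonneg (m := m) C (Finset.mem_union_right C hu) hv.1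
        (by simp [hv.2.1, hv.2.2])
      omega

/-- The decomposition of a `(1,m)`-CDS `Cs` into stars: every `u ∈ Cs` is the center of a star
whose feet are its children in a breadth-first search tree of `G[Cs]`. Each vertex belongs to at
most two of these stars, so their costs `W u` add up to at most `2 c(Cs)`. For every `C`, the
parts outside `C` of the stars with center outside `C` have gains that add up to at least
`f(C) - 1`. -/
lemma exists_star_decomposition (hm : 1 ≤ m) {Cs : Finset V} (hCs : IsCDS G m Cs) {c : V → ℝ}
    (hc : ∀ v, 0 < c v) :
    ∃ W : V → ℝ, (∀ u, 0 ≤ W u) ∧ ∑ u ∈ Cs, W u ≤ 2 * cost c Cs ∧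
      ∀ C : Finset V, ∃ l : V → List V,
        (∀ u ∈ Cs \ C, IsStar G c C u (l u) ∧ cost c (starNodes u (l u)) ≤ W u) ∧
        f G m C - 1 ≤ ∑ u ∈ Cs \ C, gain G m C u (l u) := by
  classical
  obtain ⟨r, -, par, d, hpar⟩ := exists_search_tree hCs.2
  let key : V → ℕ ×ₗ (ℝ ×ₗ Fin (Fintype.card V)) := fun v =>
    toLex (d v, toLex (c v, Fintype.equivFin V v))
  have key_inj : ∀ v w, key v = key w → v = w := by
    intro v w h
    simp only [key, EmbeddingLike.apply_eq_iff_eq, Prod.mk.injEq] at h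
    exact h.2.2
  have key_par : ∀ v ∈ Cs, v ≠ r → key (par v) < key v := by
    intro v hv hvr
    have := (hpar v hv hvr).2.2
    rw [Prod.Lex.toLex_lt_toLex]
    left
    change d (par v) < d v
    omega
  have key_cost : ∀ v w, d v = d w → key v ≤ key w → c v ≤ c w := by
    intro v w hd h
    rw [Prod.Lex.toLex_le_toLex] at h
    rcases h with h | ⟨_, h⟩
    · exact absurd hd (ne_of_lt h)
    · rw [Prod.Lex.toLex_le_toLex] at h
      rcases h with h | ⟨h, _⟩
      · exact h.le
      · exact h.le
  let ch : Finset V → V → Finset V := fun A u => A.filter (fun v => v ≠ r ∧ par v = u)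
  have ch_sum : ∀ A : Finset V, ∀ B : Finset V, ∀ g : V → ℝ, (∀ v, 0 ≤ g v) →
      ∑ u ∈ B, ∑ v ∈ ch A u, g v ≤ ∑ v ∈ A, g v := by
    intro A B g hg
    rw [← Finset.sum_biUnion]
    · refine Finset.sum_le_sum_of_subset_of_nonneg ?_ (fun v _ _ => hg v)
      intro v hv
      obtain ⟨u, _, hu⟩ := Finset.mem_biUnion.1 hv
      exact (Finset.mem_filter.1 hu).1
    · intro a _ b _ hab
      rw [Function.onFun, Finset.disjoint_left]
      intro v hva hvb
      exact hab ((Finset.mem_filter.1 hva).2.2.symm.trans (Finset.mem_filter.1 hvb).2.2)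
  refine ⟨fun u => c u + ∑ v ∈ ch Cs u, c v, fun u => add_nonneg (hc u).le
    (Finset.sum_nonneg fun v _ => (hc v).le), ?_, fun C => ?_⟩
  · rw [Finset.sum_add_distrib, two_mul]
    exact add_le_add le_rfl (ch_sum Cs Cs c fun v => (hc v).le)
  choose l hl_nodup hl_mem hl_sorted using fun u =>
    exists_sorted_enumeration key (ch (Cs \ C) u)
  have hl_toFinset : ∀ u, (l u).toFinset = ch (Cs \ C) u := by
    intro u; ext v; rw [List.mem_toFinset, hl_mem]
  have hfoot : ∀ u, ∀ v ∈ l u, v ∈ Cs ∧ v ∉ C ∧ v ≠ r ∧ par v = u := by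
    intro u v hv
    rw [hl_mem] at hv
    simp only [ch, Finset.mem_filter, Finset.mem_sdiff] at hv
    tauto
  have hstar : ∀ u ∈ Cs \ C, IsStar G c C u (l u) := by
    intro u hu
    refine ⟨(Finset.mem_sdiff.1 hu).2, hl_nodup u, ?_, ?_⟩
    · intro v hv
      obtain ⟨h1, h2, h3, h4⟩ := hfoot u v hv
      exact ⟨h4 ▸ (hpar v h1 h3).2.1, h2⟩
    · refine (hl_sorted u).imp_of_mem ?_
      intro v w hv hw hvw
      obtain ⟨h1, h2, h3, h4⟩ := hfoot u v hv
      obtain ⟨k1, k2, k3, k4⟩ := hfoot u w hw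
      refine key_cost v w ?_ hvw
      rw [(hpar v h1 h3).2.2, (hpar w k1 k3).2.2, h4, k4]
  refine ⟨l, fun u hu => ⟨hstar u hu, ?_⟩, ?_⟩
  · rw [cost, starNodes, Finset.sum_insert, hl_toFinset]
    · refine add_le_add le_rfl (Finset.sum_le_sum_of_subset_of_nonneg ?_
        fun v _ _ => (hc v).le)
      exact Finset.filter_subset_filter _ Finset.sdiff_subset
    · rw [List.mem_toFinset]
      exact (hstar u hu).center_notMem
  -- `P v`: the foot `v` joins a component that no earlier vertex of `Cs` touches.
  let P : V → Prop := fun v => qNode G m C v = 0 ∧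
    ∀ w ∈ Cs, key w < key v → Disjoint (compNbrs G C v) (compNbrs G C w)
  have hgain : ∀ u ∈ Cs \ C, ((qNode G m C u + (needyNbrs G m C u).card : ℕ) : ℤ) +
      (((compNbrs G C u).ncard : ℤ) - 1) + (((ch (Cs \ C) u).filter P).card : ℤ) ≤
        gain G m C u (l u) := by
    intro u hu
    have hu' := Finset.mem_sdiff.1 hu
    have h1 := card_filter_le_feetGain (G := G) (m := m) hm (C := C) P (l u) (Z := {u})
      (Finset.mem_singleton_self u) (hl_nodup u)
      (fun v hv => by
        have := (hstar u hu).feet v hv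
        simpa [and_comm] using this)
      (fun v hv hPv => by
        obtain ⟨h1, h2, h3, h4⟩ := hfoot u v hv
        refine ⟨hPv.1, fun z hz => ?_⟩
        rw [Finset.mem_singleton.1 hz]
        exact hPv.2 u hu'.1 (h4 ▸ key_par v h1 h3))
      (by
        refine ((hl_sorted u).and (hl_nodup u)).imp_of_mem ?_
        rintro a b ha hb ⟨hab, hne⟩ hPb
        exact hPb.2 a (hfoot u a ha).1 (lt_of_le_of_ne hab fun e => hne (key_inj _ _ e)))
    have e1 : C ∪ {u} = insert u C := by
      ext; simp
    rw [e1, hl_toFinset] at h1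
    unfold gain
    rw [neg_marginal_f hu'.2]
    push_cast
    omega
  have hsumP : ∑ u ∈ Cs \ C, (((ch (Cs \ C) u).filter P).card : ℤ) =
      ∑ v ∈ Cs \ C, if v ≠ r ∧ par v ∉ C ∧ P v then (1 : ℤ) else 0 := by
    simp only [ch, Finset.filter_filter, Finset.card_filter]
    push_cast
    rw [Finset.sum_comm]
    refine Finset.sum_congr rfl fun v hv => ?_
    by_cases h : v ≠ r ∧ par v ∉ C ∧ P v
    · rw [if_pos h]
      have h2 := (hpar v (Finset.mem_sdiff.1 hv).1 h.1).1
      rw [Finset.sum_eq_single (par v)]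
      · rw [if_pos ⟨⟨h.1, rfl⟩, h.2.2⟩]
      · intro b _ hb
        rw [if_neg (fun h' => hb h'.1.2.symm)]
      · intro h'
        exact absurd (Finset.mem_sdiff.2 ⟨h2, h.2.1⟩) h'
    · rw [if_neg h]
      refine Finset.sum_eq_zero fun u hu => if_neg fun h' => h ⟨h'.1.1, ?_, h'.2⟩
      rw [h'.1.2]
      exact (Finset.mem_sdiff.1 hu).2
  have hp := p_le (G := G) (C := C) (Cs := Cs) (fun x hx => by
      obtain ⟨y, hy⟩ := Finset.card_pos.1 (lt_of_lt_of_le hm (hCs.1 x hx))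
      exact ⟨y, (Finset.mem_filter.1 hy).1, (Finset.mem_filter.1 hy).2⟩) key
    (fun v hv hvr => ⟨(hpar v hv hvr).1, (hpar v hv hvr).2.1, key_par v hv hvr⟩)
    (fun v => (if v ≠ r ∧ par v ∉ C ∧ 0 < qNode G m C v then (1 : ℤ) else 0) +
      (if v ≠ r ∧ par v ∉ C ∧ P v then (1 : ℤ) else 0))
    (fun v => by positivity)
    (fun v hv hvC hvr hpC hd => by
      by_cases hq : 0 < qNode G m C v
      · rw [if_pos ⟨hvr, hpC, hq⟩]
        split_ifs <;> simp
      · rw [if_pos (c := v ≠ r ∧ par v ∉ C ∧ P v) ⟨hvr, hpC, by omega, hd⟩]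
        split_ifs <;> simp)
  have hq := q_le (G := G) (m := m) (C := C) hCs.1 (r := r) (par := par)
    (fun v hv hvr => ⟨(hpar v hv hvr).1, (hpar v hv hvr).2.1⟩)
  have hq' : (q G m C : ℤ) + ∑ v ∈ Cs \ C,
      (if v ≠ r ∧ par v ∉ C ∧ 0 < qNode G m C v then (1 : ℤ) else 0) ≤
      ∑ u ∈ Cs \ C, ((qNode G m C u + (needyNbrs G m C u).card : ℕ) : ℤ) := by
    rw [Finset.card_filter] at hq
    exact_mod_cast hq
  have htot := Finset.sum_le_sum hgain
  rw [Finset.sum_add_distrib, Finset.sum_add_distrib, hsumP] at htot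
  rw [Finset.sum_add_distrib, Finset.sum_add_distrib] at hp
  unfold f
  linarith

/-! ### Optimality of the star subroutine -/

lemma IsStar.sublist {c : V → ℝ} {C : Finset V} {u : V} {l l' : List V} (h : IsStar G c C u l)
    (hl : l'.Sublist l) : IsStar G c C u l' :=
  ⟨h.1, h.2.1.sublist hl, fun v hv => h.2.2.1 v (hl.subset hv), h.2.2.2.sublist hl⟩

lemma isStar_nil (c : V → ℝ) {C : Finset V} {u : V} (hu : u ∉ C) : IsStar G c C u [] :=
  ⟨hu, List.nodup_nil, by simp, List.Pairwise.nil⟩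

lemma IsCandidate.notMem {C : Finset V} {u v : V} (h : IsCandidate G m C u v) : v ∉ C :=
  fun hv => Set.disjoint_left.1 h.2.2.2 ⟨⟨v, hv⟩, rfl, Or.inl rfl⟩ ⟨⟨v, hv⟩, rfl, Or.inr h.1⟩

lemma tryFoot_cases (c : V → ℝ) (C : Finset V) (u : V) (l : List V) (v : V) :
    (tryFoot G m c C u l v = l ++ [v] ∧ footGain G m C (C ∪ starNodes u l) v = 1 ∧
      effectiveness G m c C u l ≤ 1 / c v) ∨ tryFoot G m c C u l v = l := by
  unfold tryFoot
  split_ifs with h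
  · exact Or.inl ⟨rfl, h⟩
  · exact Or.inr rfl

lemma foldl_tryFoot_append (c : V → ℝ) (C : Finset V) (u : V) (e : List V) (v : V) :
    (e ++ [v]).foldl (tryFoot G m c C u) [] =
      tryFoot G m c C u (e.foldl (tryFoot G m c C u) []) v := by
  rw [List.foldl_append]; rfl

lemma foldl_tryFoot_sublist (c : V → ℝ) (C : Finset V) (u : V) (e : List V) :
    (e.foldl (tryFoot G m c C u) []).Sublist e := by
  induction e using List.reverseRecOn with
  | nil => exact List.Sublist.refl _
  | append_singleton e v ih =>
    rw [foldl_tryFoot_append]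
    rcases tryFoot_cases (G := G) (m := m) c C u (e.foldl (tryFoot G m c C u) []) v
      with ⟨h, _⟩ | h
    · rw [h]; exact ih.append (List.Sublist.refl _)
    · rw [h]; exact ih.trans (List.sublist_append_left _ _)

lemma gain_foldl_tryFoot (c : V → ℝ) (C : Finset V) (u : V) (e : List V) :
    gain G m C u (e.foldl (tryFoot G m c C u) []) =
      -marginal (f G m) {u} C + (e.foldl (tryFoot G m c C u) []).length := by
  induction e using List.reverseRecOn with
  | nil => simp [gain_nil]
  | append_singleton e v ih =>
    rw [foldl_tryFoot_append]
    rcases tryFoot_cases (G := G) (m := m) c C u (e.foldl (tryFoot G m c C u) []) v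
      with ⟨h, h1, _⟩ | h
    · rw [h, gain_append_singleton, ih, h1, List.length_append]
      push_cast [List.length_singleton]
      ring
    · rw [h, ih]

lemma isStar_of_candidates {c : V → ℝ} {C : Finset V} {u : V} (hu : u ∉ C) {e : List V}
    (hnd : e.Nodup) (hcand : ∀ v ∈ e, IsCandidate G m C u v)
    (hs : e.Pairwise (fun v w => c v ≤ c w)) : IsStar G c C u e :=
  ⟨hu, hnd, fun v hv => ⟨(hcand v hv).1, (hcand v hv).notMem⟩, hs⟩

/-- A foot with contribution `1` and with `1 / c(v)` at least the current cost-effectiveness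
does not lower the latter. -/
lemma effectiveness_le_tryFoot {c : V → ℝ} (hc : ∀ v, 0 < c v) {C : Finset V} {u : V}
    {l : List V} {v : V} (h : IsStar G c C u (l ++ [v])) :
    effectiveness G m c C u l ≤ effectiveness G m c C u (tryFoot G m c C u l v) := by
  rcases tryFoot_cases (G := G) (m := m) c C u l v with ⟨h0, h1, h2⟩ | h0
  · have hl := h.sublist (List.sublist_append_left l [v])
    have hk := cost_starNodes_pos hc u l
    have e1 : cost c (starNodes u (l ++ [v])) = cost c (starNodes u l) + c v := by
      rw [cost_starNodes c h.center_notMem h.2.1, cost_starNodes c hl.center_notMem hl.2.1]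
      simp [add_assoc]
    rw [h0]
    unfold effectiveness at h2 ⊢
    rw [e1, gain_append_singleton, h1]
    push_cast
    rw [div_le_div_iff₀ hk (hc v), one_mul] at h2
    rw [div_le_div_iff₀ hk (add_pos hk (hc v))]
    linarith
  · rw [h0]

lemma effectiveness_foldl_mono {c : V → ℝ} (hc : ∀ v, 0 < c v) {C : Finset V} {u : V}
    (e₁ e₂ : List V) (h : IsStar G c C u (e₁ ++ e₂)) :
    effectiveness G m c C u (e₁.foldl (tryFoot G m c C u) []) ≤
      effectiveness G m c C u ((e₁ ++ e₂).foldl (tryFoot G m c C u) []) := by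
  induction e₂ using List.reverseRecOn with
  | nil => simp
  | append_singleton e v ih =>
    rw [← List.append_assoc] at h ⊢
    refine (ih (h.sublist (List.sublist_append_left _ _))).trans ?_
    rw [foldl_tryFoot_append]
    exact effectiveness_le_tryFoot hc
      (h.sublist ((foldl_tryFoot_sublist c C u _).append (List.Sublist.refl _)))

/-- While all candidates are cheap, with `R c(v) < 1` where `R` bounds the cost-effectiveness of
the stars found, the scan picks for every candidate `v` a foot that costs at most as much and
joins the same component. -/
lemma exists_foot_of_candidate (hm : 1 ≤ m) {c : V → ℝ} (hc : ∀ v, 0 < c v) {C : Finset V}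
    {u : V} (hu : u ∉ C) {R : ℝ} (e : List V) (hnd : e.Nodup)
    (hcand : ∀ v ∈ e, IsCandidate G m C u v)
    (hs : e.Pairwise (fun v w => c v ≤ c w)) (hR : ∀ v ∈ e, R * c v < 1)
    (heff : effectiveness G m c C u (e.foldl (tryFoot G m c C u) []) ≤ R) :
    ∀ v ∈ e, ∃ v' ∈ e.foldl (tryFoot G m c C u) [],
      compNbrs G C v' = compNbrs G C v ∧ c v' ≤ c v := by
  induction e using List.reverseRecOn with
  | nil => simp
  | append_singleton e v ih =>
    have hstar := isStar_of_candidates (c := c) hu hnd hcand hs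
    have heff' := (effectiveness_foldl_mono (m := m) hc e [v] hstar).trans heff
    have hsub := foldl_tryFoot_sublist (G := G) (m := m) c C u e
    have ih' := ih (hnd.sublist (List.sublist_append_left _ _))
      (fun w hw => hcand w (List.mem_append_left _ hw))
      (hs.sublist (List.sublist_append_left _ _))
      (fun w hw => hR w (List.mem_append_left _ hw)) heff'
    have hkeep : ∀ w ∈ e.foldl (tryFoot G m c C u) [],
        w ∈ (e ++ [v]).foldl (tryFoot G m c C u) [] := by
      intro w hw
      rw [foldl_tryFoot_append]
      rcases tryFoot_cases (G := G) (m := m) c C u (e.foldl (tryFoot G m c C u) []) v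
        with ⟨h, _⟩ | h
      · rw [h]; exact List.mem_append_left _ hw
      · rw [h]; exact hw
    intro w hw
    rcases List.mem_append.1 hw with hw | hw
    · obtain ⟨w', hw', h⟩ := ih' w hw
      exact ⟨w', hkeep w' hw', h⟩
    · rw [List.mem_singleton] at hw
      subst hw
      by_cases hex : ∃ w' ∈ e.foldl (tryFoot G m c C u) [], compNbrs G C w' = compNbrs G C w
      · obtain ⟨w', hw', h⟩ := hex
        exact ⟨w', hkeep w' hw', h, (List.pairwise_append.1 hs).2.2 w' (hsub.subset hw') w
          (List.mem_singleton_self _)⟩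
      · push Not at hex
        have hw := hcand w (by simp)
        have hfg : footGain G m C (C ∪ starNodes u (e.foldl (tryFoot G m c C u) [])) w = 1 := by
          refine footGain_eq_one hm (Finset.mem_insert_self _ _) hw.1 hw.notMem ?_ hw.2.1 ?_
          · rw [starNodes, Finset.mem_insert, not_or, List.mem_toFinset]
            exact ⟨hw.1.ne', fun h => (List.nodup_append.1 hnd).2.2 w (hsub.subset h) w
              (List.mem_singleton_self _) rfl⟩
          · intro z hz
            rw [starNodes, Finset.mem_insert, List.mem_toFinset] at hz
            rcases hz with rfl | hz
            · exact hw.2.2.2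
            · obtain ⟨K, hK⟩ := Set.ncard_eq_one.1 hw.2.2.1
              obtain ⟨L, hL⟩ := Set.ncard_eq_one.1
                (hcand z (List.mem_append_left _ (hsub.subset hz))).2.2.1
              have := hex z hz
              rw [hK, hL] at this ⊢
              rw [Set.disjoint_singleton]
              rintro rfl
              exact this rfl
        refine ⟨w, ?_, rfl, le_rfl⟩
        rw [foldl_tryFoot_append, tryFoot, if_pos]
        · simp
        · refine ⟨hfg, heff'.trans ?_⟩
          rw [le_div_iff₀ (hc w)]
          exact (hR w (by simp)).le

lemma mem_takeWhile_of_sorted {c : V → ℝ} {R : ℝ} (hR : 0 ≤ R) {e : List V}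
    (hs : e.Pairwise (fun v w => c v ≤ c w)) {p : V → Bool} (hp : ∀ v, p v = true ↔ R * c v < 1)
    {v : V} (hv : v ∈ e) (hcv : R * c v < 1) : v ∈ e.takeWhile p := by
  induction e with
  | nil => simp at hv
  | cons a e ih =>
    rw [List.pairwise_cons] at hs
    rcases List.mem_cons.1 hv with rfl | hv
    · rw [List.takeWhile_cons_of_pos ((hp _).2 hcv)]
      exact List.mem_cons_self
    · have ha : R * c a < 1 := (mul_le_mul_of_nonneg_left (hs.1 v hv) hR).trans_lt hcv
      rw [List.takeWhile_cons_of_pos ((hp _).2 ha)]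
      exact List.mem_cons_of_mem _ (ih hs.2 hv)

lemma pairwise_of_forall_append {α : Type*} {r : α → α → Prop} (l : List α)
    (h : ∀ l₁ v l₂, l = l₁ ++ v :: l₂ → ∀ z ∈ l₁, r z v) : l.Pairwise r := by
  induction l using List.reverseRecOn with
  | nil => exact List.Pairwise.nil
  | append_singleton l v ih =>
    rw [List.pairwise_append]
    refine ⟨ih fun l₁ w l₂ e => h l₁ w (l₂ ++ [v]) (by simp [e]), List.pairwise_singleton _ _, ?_⟩
    intro a ha b hb
    rw [List.mem_singleton.1 hb]
    exact h l v [] rfl a ha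

lemma sum_one_sub_mul {c : V → ℝ} {R : ℝ} {l : List V} (hl : l.Nodup) :
    ∑ v ∈ l.toFinset, (1 - R * c v) = l.length - R * (l.map c).sum := by
  rw [List.sum_toFinset _ hl]
  clear hl
  induction l with
  | nil => simp
  | cons a l ih =>
    simp only [List.map_cons, List.sum_cons, List.length_cons, ih]
    push_cast
    ring

/-- In a star of cost-effectiveness above `R`, a foot contributes `1` and is a candidate for
the subroutine, and its component neighbour differs from those of the earlier feet, provided
that dropping the foot, and the foot alone, give stars of cost-effectiveness at most `R`. -/
lemma candidate_of_lt_gain (hm : 1 ≤ m) {c : V → ℝ} (hc : ∀ v, 0 < c v) {C : Finset V} {R : ℝ}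
    (hR : 0 ≤ R) {u v : V} {l₁ l₂ : List V} (h : IsStar G c C u (l₁ ++ v :: l₂))
    (hgt : R * cost c (starNodes u (l₁ ++ v :: l₂)) < gain G m C u (l₁ ++ v :: l₂))
    (hdrop : (gain G m C u (l₁ ++ l₂) : ℝ) ≤ R * cost c (starNodes u (l₁ ++ l₂)))
    (htriv : (gain G m C v [] : ℝ) ≤ R * c v) :
    R * c v < 1 ∧ qNode G m C u = 0 ∧ IsCandidate G m C u v ∧
      ∀ z ∈ l₁, Disjoint (compNbrs G C v) (compNbrs G C z) := by
  have hl' := h.sublist (l' := l₁ ++ l₂)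
    (List.Sublist.append (List.Sublist.refl _) (List.sublist_cons_self _ _))
  have e1 : cost c (starNodes u (l₁ ++ v :: l₂)) = cost c (starNodes u (l₁ ++ l₂)) + c v := by
    rw [cost_starNodes c h.center_notMem h.2.1, cost_starNodes c hl'.center_notMem hl'.2.1]
    simp only [List.map_append, List.sum_append, List.map_cons, List.sum_cons]
    ring
  have huv := (h.feet v (by simp)).1
  have hvC : v ∉ C := fun hv => (h.feet v (by simp)).2 (Finset.mem_insert_of_mem hv)
  have hb1 := footGain_le_one (G := G) (m := m) C (C ∪ starNodes u l₁) v
  have hbR : R * c v < footGain G m C (C ∪ starNodes u l₁) v := by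
    have h1 : (gain G m C u (l₁ ++ v :: l₂) : ℝ) ≤
        gain G m C u (l₁ ++ l₂) + footGain G m C (C ∪ starNodes u l₁) v := by
      exact_mod_cast gain_append_cons_le h
    rw [e1, mul_add] at hgt
    linarith
  have hb0 : 0 < footGain G m C (C ∪ starNodes u l₁) v := by
    have : (0 : ℝ) < footGain G m C (C ∪ starNodes u l₁) v :=
      (mul_nonneg hR (hc v).le).trans_lt hbR
    exact_mod_cast this
  have hb : footGain G m C (C ∪ starNodes u l₁) v = 1 := by omega
  have hRv : R * c v < 1 := by rw [hb] at hbR; exact_mod_cast hbR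
  have hq : qNode G m C v = 0 := by
    by_contra hq
    rw [footGain, if_pos (Nat.pos_of_ne_zero hq)] at hb0
    exact lt_irrefl _ hb0
  obtain ⟨x, hx, hvx⟩ := exists_adj_of_qNode_eq_zero hm hvC hq
  have hNC : 1 ≤ (compNbrs G C v).ncard := one_le_ncard_compNbrs hx hvx.symm
  have htriv0 : gain G m C v [] < 1 := by exact_mod_cast htriv.trans_lt hRv
  rw [gain_nil, neg_marginal_f hvC] at htriv0
  have hneedy : needyNbrs G m C v = ∅ := by
    rw [← Finset.card_eq_zero]; omega
  have hNC1 : (compNbrs G C v).ncard = 1 := by omega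
  have hqu : qNode G m C u = 0 := by
    by_contra hqu
    have : u ∈ needyNbrs G m C v :=
      Finset.mem_filter.2 ⟨Finset.mem_compl.2 h.1, huv.symm, Nat.pos_of_ne_zero hqu⟩
    rw [hneedy] at this
    exact Finset.notMem_empty _ this
  have hvD : v ∉ C ∪ starNodes u l₁ := by
    have := (List.nodup_append.1 h.2.1).2.2
    simp only [starNodes, Finset.mem_union, Finset.mem_insert, List.mem_toFinset, not_or]
    exact ⟨hvC, huv.ne', fun hv => this v hv v List.mem_cons_self rfl⟩
  have h2 : 2 ≤ (compNbrs G (C ∪ starNodes u l₁) v).ncard := by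
    have h3 : 1 ≤ -marginal (f G m) {v} (C ∪ starNodes u l₁) := by
      rw [← hb, footGain, if_neg (by omega)]
      exact min_le_right _ _
    have h4 := qNode_antitone (G := G) (m := m)
      (Finset.subset_union_left (s₁ := C) (s₂ := starNodes u l₁)) v
    have h5 : needyNbrs G m (C ∪ starNodes u l₁) v = ∅ := by
      rw [← Finset.subset_empty, ← hneedy]
      exact needyNbrs_antitone Finset.subset_union_left v
    rw [neg_marginal_f hvD, h5] at h3
    simp only [Finset.card_empty] at h3
    omega
  have hdis : ∀ z ∈ starNodes u l₁, Disjoint (compNbrs G C v) (compNbrs G C z) := by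
    intro z hz
    by_contra hnd
    have := ncard_compNbrs_le_one (Z := starNodes u l₁) (Finset.mem_insert_self u _) hvD
      (fun y hy => by
        rw [starNodes, Finset.mem_insert, List.mem_toFinset] at hy
        exact hy.imp_right fun hy => (h.feet y (by simp [hy])).1) hNC1 hz hnd
    exact absurd (h2.trans this) (by norm_num)
  exact ⟨hRv, hqu, ⟨huv, hq, hNC1, hdis u (Finset.mem_insert_self _ _)⟩,
    fun z hz => hdis z (by simp [starNodes, hz])⟩

/-- No star beats the best star found by the scans: otherwise take a counterexample with the
fewest feet. Its feet are candidates that join distinct components, and the scan of its center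
finds for each of them a foot that is at least as good. -/
lemma gain_le_of_scanFeet_le (hm : 1 ≤ m) {c : V → ℝ} (hc : ∀ v, 0 < c v) {C : Finset V}
    {R : ℝ} (hR : 0 ≤ R) {e : V → List V}
    (he : ∀ w ∉ C, (e w).Nodup ∧ (∀ v, v ∈ e w ↔ IsCandidate G m C w v) ∧
      (e w).Pairwise (fun v v' => c v ≤ c v'))
    (heff : ∀ w ∉ C, effectiveness G m c C w (scanFeet G m c C w (e w)) ≤ R)
    (n : ℕ) (u : V) (l : List V) (hn : l.length = n) (h : IsStar G c C u l) :
    (gain G m C u l : ℝ) ≤ R * cost c (starNodes u l) := by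
  classical
  have hestar : ∀ w ∉ C, IsStar G c C w (e w) := fun w hw =>
    isStar_of_candidates hw (he w hw).1 (fun v hv => ((he w hw).2.1 v).1 hv) (he w hw).2.2
  have htrivial : ∀ w ∉ C, (gain G m C w [] : ℝ) ≤ R * c w := by
    intro w hw
    have h1 : effectiveness G m c C w [] ≤
        effectiveness G m c C w (scanFeet G m c C w (e w)) := by
      unfold scanFeet
      split_ifs
      · exact effectiveness_foldl_mono hc [] (e w) (hestar w hw)
      · exact le_rfl
    have h2 := h1.trans (heff w hw)
    have e1 : cost c (starNodes w []) = c w := by simp [cost, starNodes]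
    rwa [effectiveness, e1, div_le_iff₀ (hc w)] at h2
  induction n using Nat.strong_induction_on generalizing u l with
  | _ n ih =>
  by_contra! hgt
  have hfeet : ∀ l₁ v l₂, l = l₁ ++ v :: l₂ → R * c v < 1 ∧ qNode G m C u = 0 ∧
      IsCandidate G m C u v ∧ ∀ z ∈ l₁, Disjoint (compNbrs G C v) (compNbrs G C z) := by
    rintro l₁ v l₂ rfl
    refine candidate_of_lt_gain hm hc hR h hgt (ih (l₁ ++ l₂).length ?_ u _ rfl
      (h.sublist (List.Sublist.append (List.Sublist.refl _) (List.sublist_cons_self _ _))))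
      (htrivial v fun hv => (h.feet v (by simp)).2 (Finset.mem_insert_of_mem hv))
    rw [← hn]
    simp only [List.length_append, List.length_cons]
    omega
  have hfoot : ∀ v ∈ l, R * c v < 1 ∧ qNode G m C u = 0 ∧ IsCandidate G m C u v := by
    intro v hv
    obtain ⟨l₁, l₂, hl⟩ := List.append_of_mem hv
    have := hfeet l₁ v l₂ hl
    exact ⟨this.1, this.2.1, this.2.2.1⟩
  have hpw : l.Pairwise (fun a b => Disjoint (compNbrs G C a) (compNbrs G C b)) :=
    pairwise_of_forall_append l fun l₁ v l₂ hl z hz => ((hfeet l₁ v l₂ hl).2.2.2 z hz).symm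
  have hl_ne : l ≠ [] := by
    rintro rfl
    have := htrivial u h.1
    have e1 : cost c (starNodes u []) = c u := by simp [cost, starNodes]
    rw [e1] at hgt
    exact absurd this (not_le.2 hgt)
  obtain ⟨v₀, hv₀⟩ := List.exists_mem_of_ne_nil l hl_ne
  have hqu := (hfoot v₀ hv₀).2.1
  obtain ⟨hnd, hmem, hsort⟩ := he u h.1
  -- The cheap candidates come first in the enumeration.
  set p : V → Bool := fun v => decide (R * c v < 1)
  have hp : ∀ v, p v = true ↔ R * c v < 1 := fun v => by simp [p]
  have hsub : ((e u).takeWhile p).Sublist (e u) := List.takeWhile_sublist p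
  have hLR : effectiveness G m c C u (((e u).takeWhile p).foldl (tryFoot G m c C u) []) ≤ R := by
    have h1 := heff u h.1
    rw [scanFeet, if_pos hqu] at h1
    refine (effectiveness_foldl_mono hc _ ((e u).dropWhile p) ?_).trans ?_
    · rw [List.takeWhile_append_dropWhile]
      exact hestar u h.1
    · rw [List.takeWhile_append_dropWhile]
      exact h1
  have hpick := exists_foot_of_candidate hm hc h.1 ((e u).takeWhile p) (hnd.sublist hsub)
    (fun v hv => (hmem v).1 (hsub.subset hv)) (hsort.sublist hsub)
    (fun v hv => (hp v).1 (List.mem_takeWhile_imp hv)) hLR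
  have hLgain := gain_foldl_tryFoot (G := G) (m := m) c C u ((e u).takeWhile p)
  have hLsub := foldl_tryFoot_sublist (G := G) (m := m) c C u ((e u).takeWhile p)
  set L := ((e u).takeWhile p).foldl (tryFoot G m c C u) []
  have hLstar : IsStar G c C u L := (hestar u h.1).sublist (hLsub.trans hsub)
  have hpick' : ∀ v ∈ l, ∃ v' ∈ L, compNbrs G C v' = compNbrs G C v ∧ c v' ≤ c v := fun v hv =>
    hpick v (mem_takeWhile_of_sorted hR hsort hp ((hmem v).2 (hfoot v hv).2.2) (hfoot v hv).1)
  choose! φ hφL hφK hφc using hpick'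
  have hφinj : Set.InjOn φ (l.toFinset : Set V) := by
    intro a ha b hb hab
    rw [Finset.mem_coe, List.mem_toFinset] at ha hb
    by_contra hne
    have hsymm : Std.Symm (fun a b => Disjoint (compNbrs G C a) (compNbrs G C b)) :=
      ⟨fun _ _ h => h.symm⟩
    have hd : Disjoint (compNbrs G C a) (compNbrs G C b) := hpw.forall ha hb hne
    have hK : compNbrs G C a = compNbrs G C b := by
      rw [← hφK a ha, ← hφK b hb, hab]
    rw [hK, disjoint_self] at hd
    have h1 := (hfoot b hb).2.2.2.2.1
    rw [hd] at h1
    simp at h1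
  have hsum : ∑ v ∈ l.toFinset, (1 - R * c v) ≤ ∑ v ∈ L.toFinset, (1 - R * c v) := by
    calc ∑ v ∈ l.toFinset, (1 - R * c v) ≤ ∑ v ∈ l.toFinset, (1 - R * c (φ v)) := by
          refine Finset.sum_le_sum fun v hv => ?_
          have := mul_le_mul_of_nonneg_left (hφc v (List.mem_toFinset.1 hv)) hR
          linarith
      _ = ∑ v ∈ l.toFinset.image φ, (1 - R * c v) :=
          (Finset.sum_image (f := fun v => 1 - R * c v) hφinj).symm
      _ ≤ ∑ v ∈ L.toFinset, (1 - R * c v) := by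
          refine Finset.sum_le_sum_of_subset_of_nonneg ?_ fun v hv _ => ?_
          · intro v hv
            obtain ⟨w, hw, rfl⟩ := Finset.mem_image.1 hv
            exact List.mem_toFinset.2 (hφL w (List.mem_toFinset.1 hw))
          · have := (hp v).1 (List.mem_takeWhile_imp (hLsub.subset (List.mem_toFinset.1 hv)))
            linarith
  rw [sum_one_sub_mul h.2.1, sum_one_sub_mul hLstar.2.1] at hsum
  rw [effectiveness, div_le_iff₀ (cost_starNodes_pos hc u L), hLgain,
    cost_starNodes c hLstar.center_notMem hLstar.2.1] at hLR
  have hg : (gain G m C u l : ℝ) ≤ ((-marginal (f G m) {u} C + l.length : ℤ) : ℝ) := by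
    exact_mod_cast gain_le_add_length C u l
  rw [cost_starNodes c h.center_notMem h.2.1] at hgt
  push_cast at hLR hg
  linarith

lemma IsSubroutineStar.isStar {c : V → ℝ} {C : Finset V} {u : V} {l : List V}
    (h : IsSubroutineStar G m c C u l) : IsStar G c C u l := by
  obtain ⟨e, he, hu, rfl, -⟩ := h
  unfold scanFeet
  split_ifs
  · exact (isStar_of_candidates hu (he u hu).1 (fun v hv => ((he u hu).2.1 v).1 hv)
      (he u hu).2.2).sublist (foldl_tryFoot_sublist c C u _)
  · exact isStar_nil c hu

/-- As long as the loop condition holds, the subroutine returns a most cost-effective star. -/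
lemma IsSubroutineStar.isMostCostEffective (hm : 1 ≤ m) {c : V → ℝ} (hc : ∀ v, 0 < c v)
    {C : Finset V} (hloop : LoopCondition G m c C) {u : V} {l : List V}
    (h : IsSubroutineStar G m c C u l) : IsMostCostEffective G m c C u l := by
  refine ⟨h.isStar, ?_⟩
  obtain ⟨e, he, hu, hl, hmax, -⟩ := h
  -- The bound on all stars needs a nonnegative `R`; a star of positive gain then shows that
  -- the maximum with `0` is superfluous.
  have key := fun w k hk => gain_le_of_scanFeet_le hm hc
    (le_max_right (effectiveness G m c C u l) 0) he
    (fun w hw => (hmax w hw).trans (le_max_left _ _)) _ w k rfl hk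
  obtain ⟨w₀, k₀, hs₀, hg₀⟩ := hloop
  have h0 : 0 < max (effectiveness G m c C u l) 0 := by
    have h1 : (0 : ℝ) < gain G m C w₀ k₀ := by exact_mod_cast hg₀
    exact pos_of_mul_pos_left (h1.trans_le (key w₀ k₀ hs₀)) (cost_starNodes_pos hc w₀ k₀).le
  have hE : max (effectiveness G m c C u l) 0 = effectiveness G m c C u l := by
    rcases max_cases (effectiveness G m c C u l) 0 with h2 | h2
    · exact h2.1
    · exact absurd h0 (by rw [h2.1]; exact lt_irrefl _)
  intro w k hk
  have := key w k hk
  rw [hE] at this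
  rw [effectiveness, div_le_iff₀ (cost_starNodes_pos hc w k)]
  exact this

lemma exists_subroutineStar (c : V → ℝ) {C : Finset V} (hC : Cᶜ.Nonempty) :
    ∃ u l, IsSubroutineStar G m c C u l := by
  classical
  choose e he_nodup he_mem he_sorted using fun w =>
    exists_sorted_enumeration c (Finset.univ.filter (IsCandidate G m C w))
  let E : V → ℝ := fun w => effectiveness G m c C w (scanFeet G m c C w (e w))
  obtain ⟨u, hu, hmax⟩ := Finset.exists_max_image Cᶜ E hC
  have hmax' : ∀ w ∉ C, E w ≤ E u := fun w hw => hmax w (Finset.mem_compl.2 hw)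
  have he : ∀ w ∉ C, (e w).Nodup ∧ (∀ v, v ∈ e w ↔ IsCandidate G m C w v) ∧
      (e w).Pairwise (fun v v' => c v ≤ c v') := fun w _ =>
    ⟨he_nodup w, fun v => by rw [he_mem]; simp, he_sorted w⟩
  by_cases htriv : ∃ w ∉ C, scanFeet G m c C w (e w) = [] ∧
      effectiveness G m c C w [] = E u
  · obtain ⟨w, hw, h1, h2⟩ := htriv
    have h3 : E w = E u := by simp only [E] at h2 ⊢; rw [h1, h2]
    exact ⟨w, _, e, he, hw, rfl, fun v hv => (hmax' v hv).trans h3.ge, fun _ => h1⟩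
  · exact ⟨u, _, e, he, Finset.mem_compl.1 hu, rfl, hmax', fun h => absurd h htriv⟩

/-! ### The amortized bound -/

lemma one_le_f [Nonempty V] (hm : 1 ≤ m) (C : Finset V) : 1 ≤ f G m C := by
  unfold f
  rcases C.eq_empty_or_nonempty with rfl | ⟨x, hx⟩
  · -- Here `p = 0`, but every vertex is deficient.
    have : 1 ≤ q G m (∅ : Finset V) := by
      obtain ⟨v⟩ := ‹Nonempty V›
      have h1 : qNode G m ∅ v = m := by simp [qNode, nbrsIn]
      refine hm.trans (h1.ge.trans ?_)
      exact Finset.single_le_sum (f := fun v => qNode G m ∅ v) (fun _ _ => Nat.zero_le _)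
        (by simp)
    omega
  · have : 0 < p G C := by
      have : Nonempty (G.induce (C : Set V)).ConnectedComponent :=
        ⟨(G.induce (C : Set V)).connectedComponentMk ⟨x, hx⟩⟩
      exact Nat.card_pos
    omega

lemma IsMostCostEffective.gain_pos {c : V → ℝ} (hc : ∀ v, 0 < c v) {C : Finset V} {u : V}
    {l : List V} (h : IsMostCostEffective G m c C u l) (hloop : LoopCondition G m c C) :
    0 < gain G m C u l := by
  obtain ⟨w, k, hs, hg⟩ := hloop
  have h1 : (0 : ℝ) < effectiveness G m c C w k :=
    div_pos (by exact_mod_cast hg) (cost_starNodes_pos hc w k)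
  have h2 := h1.trans_le (h.2 w k hs)
  unfold effectiveness at h2
  have := (div_pos_iff_of_pos_right (cost_starNodes_pos hc u l)).1 h2
  exact_mod_cast this

/-- If a most cost-effective star has the price `θ = c(S) / g_C(S)` per unit of gain, then at
least `f(C) - 1` of the numbers `W u / (k + 1)`, with `u ∈ Cs` and `k < δ_max + m - 1`, are at
least `θ`: the star of `u` has a gain of at most `δ_max + m - 1` and of at most `W u / θ`. -/
lemma f_sub_one_le_card (hm : 1 ≤ m) {c : V → ℝ} (hc : ∀ v, 0 < c v) {Cs C : Finset V}
    {W : V → ℝ} {k : V → List V}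
    (hk : ∀ u ∈ Cs \ C, IsStar G c C u (k u) ∧ cost c (starNodes u (k u)) ≤ W u)
    (hsum : f G m C - 1 ≤ ∑ u ∈ Cs \ C, gain G m C u (k u)) {u : V} {l : List V}
    (h : IsMostCostEffective G m c C u l) (hg : 0 < gain G m C u l) :
    f G m C - 1 ≤ ((Cs ×ˢ Finset.range (G.maxDegree + m - 1)).filter (fun x =>
      cost c (starNodes u l) / gain G m C u l ≤ W x.1 / (x.2 + 1))).card := by
  have hg' : (0 : ℝ) < gain G m C u l := by exact_mod_cast hg
  have hS := cost_starNodes_pos hc u l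
  let A : V → Finset ℕ := fun v => (Finset.range (G.maxDegree + m - 1)).filter (fun i =>
    cost c (starNodes u l) / gain G m C u l ≤ W v / ((i : ℝ) + 1))
  have hcard : (((Cs ×ˢ Finset.range (G.maxDegree + m - 1)).filter (fun x =>
      cost c (starNodes u l) / gain G m C u l ≤ W x.1 / (x.2 + 1))).card) =
      ∑ v ∈ Cs, (A v).card := by
    simp only [A, Finset.card_filter]
    rw [Finset.sum_product]
  have hA : ∀ v ∈ Cs \ C, gain G m C v (k v) ≤ (A v).card := by
    intro v hv
    obtain ⟨h1, h2⟩ := hk v hv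
    have h3 := gain_le_maxDegree hm h1
    have h4 : Finset.range (gain G m C v (k v)).toNat ⊆ A v := by
      intro i hi
      rw [Finset.mem_range] at hi
      refine Finset.mem_filter.2 ⟨Finset.mem_range.2 (by omega), ?_⟩
      have h5 : ((i : ℝ) + 1) ≤ gain G m C v (k v) := by
        have : (i : ℤ) + 1 ≤ gain G m C v (k v) := by omega
        exact_mod_cast this
      have h6 := h.2 v (k v) h1
      unfold effectiveness at h6
      rw [div_le_div_iff₀ (cost_starNodes_pos hc v (k v)) hS] at h6
      rw [div_le_div_iff₀ hg' (by positivity)]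
      calc cost c (starNodes u l) * ((i : ℝ) + 1)
          ≤ cost c (starNodes u l) * gain G m C v (k v) :=
            mul_le_mul_of_nonneg_left h5 hS.le
        _ ≤ cost c (starNodes v (k v)) * gain G m C u l := by linarith
        _ ≤ W v * gain G m C u l := mul_le_mul_of_nonneg_right h2 hg'.le
    have h7 := Finset.card_le_card h4
    rw [Finset.card_range] at h7
    omega
  rw [hcard]
  refine hsum.trans ((Finset.sum_le_sum hA).trans ?_)
  push_cast
  exact Finset.sum_le_sum_of_subset_of_nonneg Finset.sdiff_subset
    fun _ _ _ => Int.natCast_nonneg _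

/-- The cost of the nodes chosen so far is paid for by the numbers `W u / (k + 1)` even after
any `f(C) - 1` of them are set aside. -/
lemma cost_add_sum_le [Nonempty V] (hm : 1 ≤ m) {c : V → ℝ} (hc : ∀ v, 0 < c v)
    {Cs : Finset V} {W : V → ℝ} (hW0 : ∀ u, 0 ≤ W u)
    (hW : ∀ C : Finset V, ∃ k : V → List V,
        (∀ u ∈ Cs \ C, IsStar G c C u (k u) ∧ cost c (starNodes u (k u)) ≤ W u) ∧
        f G m C - 1 ≤ ∑ u ∈ Cs \ C, gain G m C u (k u))
    {sel : Finset V → V → List V → Prop}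
    (hsel : ∀ C u l, LoopCondition G m c C → sel C u l → IsMostCostEffective G m c C u l)
    {C : Finset V} (hC : Reaches G m c sel C)
    (A : Finset (V × ℕ)) (hA : A ⊆ Cs ×ˢ Finset.range (G.maxDegree + m - 1))
    (hAf : (A.card : ℤ) ≤ f G m C - 1) :
    cost c C + ∑ x ∈ A, W x.1 / (x.2 + 1) ≤
      ∑ x ∈ Cs ×ˢ Finset.range (G.maxDegree + m - 1), W x.1 / (x.2 + 1) := by
  have hval : ∀ x : V × ℕ, 0 ≤ W x.1 / ((x.2 : ℝ) + 1) := fun x =>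
    div_nonneg (hW0 _) (by positivity)
  induction hC generalizing A with
  | start =>
    rw [cost, Finset.sum_empty, zero_add]
    exact Finset.sum_le_sum_of_subset_of_nonneg hA fun x _ _ => hval x
  | step C u l hC hloop hs ih =>
    have hmce := hsel C u l hloop hs
    have hg := hmce.gain_pos hc hloop
    have hdrop := gain_le_sub (m := m) hmce.1
    obtain ⟨k, hk, hsum⟩ := hW C
    have hcard := f_sub_one_le_card hm hc hk hsum hmce hg
    set θ := cost c (starNodes u l) / gain G m C u l with hθ
    set T := (Cs ×ˢ Finset.range (G.maxDegree + m - 1)).filter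
      (fun x => θ ≤ W x.1 / ((x.2 : ℝ) + 1))
    have hg' : (0 : ℝ) < gain G m C u l := by exact_mod_cast hg
    have hθ0 : 0 ≤ θ := div_nonneg (cost_starNodes_pos hc u l).le hg'.le
    -- Enlarge `A` by as many pairs of value at least `θ` as the potential drops.
    obtain ⟨B, hBT, hBcard⟩ : ∃ B ⊆ T \ A,
        B.card = (f G m C - f G m (C ∪ starNodes u l)).toNat := by
      apply Finset.exists_subset_card_eq
      have := Finset.le_card_sdiff A T
      omega
    have hdisj : Disjoint A B := by
      rw [Finset.disjoint_left]
      exact fun x hxA hxB => (Finset.mem_sdiff.1 (hBT hxB)).2 hxA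
    have hBT' : B ⊆ T := hBT.trans Finset.sdiff_subset
    have h1 := ih (A ∪ B) (Finset.union_subset hA (hBT'.trans (Finset.filter_subset _ _))) (by
      rw [Finset.card_union_of_disjoint hdisj]
      push_cast
      omega)
    rw [Finset.sum_union hdisj] at h1
    have h2 : (B.card : ℝ) * θ ≤ ∑ x ∈ B, W x.1 / ((x.2 : ℝ) + 1) := by
      rw [← nsmul_eq_mul]
      exact Finset.card_nsmul_le_sum _ _ _ fun x hx => (Finset.mem_filter.1 (hBT' hx)).2
    have h3 : (gain G m C u l : ℝ) ≤ B.card := by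
      have : gain G m C u l ≤ B.card := by omega
      exact_mod_cast this
    have h4 : cost c (starNodes u l) ≤ B.card * θ := by
      have : cost c (starNodes u l) = gain G m C u l * θ := by
        rw [hθ]; field_simp
      rw [this]
      exact mul_le_mul_of_nonneg_right h3 hθ0
    have h5 : cost c (C ∪ starNodes u l) ≤ cost c C + cost c (starNodes u l) := by
      unfold cost
      rw [← Finset.sum_union_inter]
      exact le_add_of_nonneg_right (Finset.sum_nonneg fun v _ => (hc v).le)
    linarith

lemma IsOutput.cost_le [Nonempty V] (hm : 1 ≤ m) {c : V → ℝ} (hc : ∀ v, 0 < c v)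
    {Cs : Finset V} (hCs : IsCDS G m Cs) {sel : Finset V → V → List V → Prop}
    (hsel : ∀ C u l, LoopCondition G m c C → sel C u l → IsMostCostEffective G m c C u l)
    {C : Finset V} (hC : IsOutput G m c sel C) :
    cost c C ≤ 2 * ((harmonic (G.maxDegree + m - 1) : ℚ) : ℝ) * cost c Cs := by
  obtain ⟨W, hW0, hWsum, hW⟩ := exists_star_decomposition (G := G) hm hCs hc
  have h1 := cost_add_sum_le hm hc hW0 hW hsel hC.1 ∅ (Finset.empty_subset _)
    (by have := one_le_f (G := G) hm C; simpa using this)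
  rw [Finset.sum_empty, add_zero, Finset.sum_product] at h1
  have h2 : ∑ u ∈ Cs, ∑ i ∈ Finset.range (G.maxDegree + m - 1), W u / ((i : ℝ) + 1) =
      (∑ u ∈ Cs, W u) * ((harmonic (G.maxDegree + m - 1) : ℚ) : ℝ) := by
    rw [Finset.sum_mul]
    refine Finset.sum_congr rfl fun u _ => ?_
    rw [harmonic]
    push_cast
    rw [Finset.mul_sum]
    rfl
  have h3 : (0 : ℝ) ≤ ((harmonic (G.maxDegree + m - 1) : ℚ) : ℝ) := by
    rw [harmonic]
    push_cast
    positivity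
  have h4 := mul_le_mul_of_nonneg_right hWsum h3
  calc cost c C ≤ _ := h1
    _ = _ := h2
    _ ≤ _ := h4
    _ = _ := by ring

lemma Reaches.exists_isOutput {c : V → ℝ} {sel : Finset V → V → List V → Prop}
    (hsel : ∀ C, LoopCondition G m c C → ∃ u l, u ∉ C ∧ sel C u l) (n : ℕ) (C : Finset V)
    (hn : Cᶜ.card = n) (hC : Reaches G m c sel C) : ∃ D, IsOutput G m c sel D := by
  induction n using Nat.strong_induction_on generalizing C with
  | _ n ih =>
  by_cases hloop : LoopCondition G m c C
  · obtain ⟨u, l, hu, hs⟩ := hsel C hloop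
    refine ih _ ?_ (C ∪ starNodes u l) rfl (hC.step C u l hloop hs)
    rw [← hn]
    refine Finset.card_lt_card (Finset.compl_ssubset_compl.2 ?_)
    refine ⟨Finset.subset_union_left, fun h => hu (h ?_)⟩
    simp [starNodes]
  · exact ⟨C, hC, hloop⟩

end MinWCDS

/-- The greedy algorithm that calls the star subroutine has an output, and each of its outputs
`C` has cost at most `2 H(δ_max + m - 1)` times the optimum; the bound also holds when each pass
of the loop adds an arbitrary most cost-effective star. -/
theorem theorem1 {V : Type*} [Fintype V] [DecidableEq V] (G : SimpleGraph V)
    [DecidableRel G.Adj] (hG : G.Connected) (m : ℕ) (hm : 1 ≤ m)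
    (c : V → ℝ) (hc : ∀ v, 0 < c v)
    (Cstar : Finset V) (hCstar : MinWCDS.IsOptimalCDS G m c Cstar) :
    (∃ C, MinWCDS.IsOutput G m c (MinWCDS.IsSubroutineStar G m c) C) ∧
    (∀ C, MinWCDS.IsOutput G m c (MinWCDS.IsSubroutineStar G m c) C →
      MinWCDS.cost c C ≤
        2 * ((harmonic (G.maxDegree + m - 1) : ℚ) : ℝ) * MinWCDS.cost c Cstar) ∧
    (∀ C, MinWCDS.IsOutput G m c (MinWCDS.IsMostCostEffective G m c) C →
      MinWCDS.cost c C ≤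
        2 * ((harmonic (G.maxDegree + m - 1) : ℚ) : ℝ) * MinWCDS.cost c Cstar) := by
  have := hG.nonempty
  refine ⟨?_, fun C hC => ?_, fun C hC => ?_⟩
  · refine MinWCDS.Reaches.exists_isOutput (fun C hloop => ?_) _ ∅ rfl MinWCDS.Reaches.start
    obtain ⟨w, k, hs, -⟩ := hloop
    obtain ⟨u, l, h⟩ := MinWCDS.exists_subroutineStar (G := G) (m := m) c
      ⟨w, Finset.mem_compl.2 hs.1⟩
    exact ⟨u, l, h.isStar.1, h⟩
  · exact hC.cost_le hm hc hCstar.1 fun C u l hloop h => h.isMostCostEffective hm hc hloop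
  · exact hC.cost_le hm hc hCstar.1 fun C u l _ h => h
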